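/- Let $M$ be a smooth manifold (Hausdorff, second countable, without boundary, of dimension $n$). \emph{The tangent groupoid.} Say that a smooth real-valued function on $M\times M$ vanishes to order $p\ge 1$ or more on the diagonal if it is locally a sum of products of $p$ or more smooth functions vanishing on the diagonal; for $p\le 0$ every smooth function does. Let $A(\mathbb{T}M)$ be the algebra of Laurent polynomials $\sum_{p\in\mathbb{Z}} f_p t^{-p}$ with $f_p\in C^\infty(M\times M)$ vanishing to order $p$ or more on the diagonal. The tangent groupoid is, as a set, $\mathbb{T}M = TM\times\{0\}\,\sqcup\, M\times M\times\mathbb{R}^\times$. An element of $A(\mathbb{T}M)$ is evaluated at $(m_1,m_2,\lambda)$, $\lambda\neq 0$, as $\sum_p f_p(m_1,m_2)\lambda^{-p}$, and at $X_m\in T_mM$ as $\sum_{p\ge 0}\frac{1}{p!}X^p(f_p)(m,m)$, where $X$ is a vector field extending the tangent vector $(X_m,0)$ at $(m,m)$ (the value does not depend on the extension). $\mathbb{T}M$ has the weakest topology for which these evaluations are continuous, and a function on $\mathbb{T}M$ is smooth if it is locally of the form $h(a_1,\dots,a_k)$ with $a_j\in A(\mathbb{T}M)$ and $h\in C^\infty(\mathbb{R}^k)$.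 The source and target maps $s,t\colon\mathbb{T}M\to M\times\mathbb{R}$ are $s(m_1,m_2,\lambda)=(m_2,\lambda)$, $t(m_1,m_2,\lambda)=(m_1,\lambda)$, $s(X_m)=t(X_m)=(m,0)$, and the composition is $(m_1,m_2,\lambda)\circ(m_2,m_3,\lambda)=(m_1,m_3,\lambda)$, $X_m\circ Y_m=X_m+Y_m$. The source fiber $\mathbb{T}M_{(m,\lambda)}=s^{-1}(m,\lambda)$ is identified with $M$ (by $m_1\mapsto(m_1,m,\lambda)$) if $\lambda\ne0$, and with $T_mM$ if $\lambda=0$. \emph{Model operators.} Let $D$ be a linear partial differential operator of order (at most) $q$ on $M$, acting on $C^\infty(M)$, so that in local coordinates $D=\sum_{k\le q}\sum_{i_1,\dots,i_k}a^{i_1\cdots i_k}\partial_{i_1}\cdots\partial_{i_k}$ with smooth coefficients. For $m\in M$ the model operator $D_m$ is the constant-coefficient operator $\sum_{i_1,\dots,i_q}a^{i_1\cdots i_q}(m)\,\partial_{i_1}\cdots\partial_{i_q}$ on $T_mM$, obtained by freezing the coefficients at $m$ and dropping the terms of order less than $q$, where $\partial_i$ is now the directional derivative along the coordinate vector $\partial/\partial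 x_i|_m\in T_mM$. \textbf{Theorem.} The operator $D_m$ on $T_mM$ does not depend on the local coordinates or on the local coordinate expression for $D$, and the formula \[ D_{(m,\lambda)}=\begin{cases}\lambda^qD & \lambda\neq0\\ D_m&\lambda=0\end{cases} \] defines a smooth and equivariant family of differential operators on the source fibers of $\mathbb{T}M$. That is: (i) each $D_{(m,\lambda)}$ is a differential operator of order at most $q$ on the source fiber $\mathbb{T}M_{(m,\lambda)}$, and for every smooth function $f$ on $\mathbb{T}M$ the function obtained by applying the operators $D_{(m,\lambda)}$ to $f$ source fiber by source fiber is again smooth on $\mathbb{T}M$; (ii) for every $\gamma\in\mathbb{T}M$, with right translation $R_\gamma\colon\mathbb{T}M_{t(\gamma)}\to\mathbb{T}M_{s(\gamma)}$, $\eta\mapsto\eta\circ\gamma$, and every smooth function $f$ on $\mathbb{T}M_{s(\gamma)}$, one has $D_{t(\gamma)}(f\circ R_\gamma)=(D_{s(\gamma)}f)\circ R_\gamma$. -/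

import Mathlib

open scoped Manifold ContDiff LaurentPolynomial Topology

noncomputable section

universe u

/-! ### Order of vanishing and the coordinate algebra `A(V, S)` -/

section DeformationAlgebra

variable {E : Type*} [NormedAddCommGroup E] [NormedSpace ℝ E] {H : Type*} [TopologicalSpace H]
  (I : ModelWithCorners ℝ E H) {V : Type*} [TopologicalSpace V] [ChartedSpace H V]

/-- The ideal of the smooth real-valued functions on `V` that vanish on `S`. -/
def smoothVanishingIdeal (S : Set V) : Ideal C^∞⟮I, V; ℝ⟯ where
  carrier := {f | ∀ v ∈ S, f v = 0}
  add_mem' := by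
    intro f g hf hg v hv
    simp [hf v hv, hg v hv]
  zero_mem' := by
    intro v _
    simp
  smul_mem' := by
    intro c f hf v hv
    simp [hf v hv]

/-- `f` vanishes to order `p` or more on `S`: near every point it is a finite sum of products of
`p` (or more) smooth functions that vanish on `S`. For `p ≤ 0` the power of the ideal is the unit
ideal and the condition is empty. -/
def VanishesToOrder (S : Set V) (p : ℤ) (f : C^∞⟮I, V; ℝ⟯) : Prop :=
  ∀ v : V, ∃ g ∈ (smoothVanishingIdeal I S) ^ p.toNat, (f : V → ℝ) =ᶠ[𝓝 v] g

variable {I}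

theorem VanishesToOrder.zero (S : Set V) (p : ℤ) :
    VanishesToOrder I S p (0 : C^∞⟮I, V; ℝ⟯) :=
  fun _ => ⟨0, Ideal.zero_mem _, Filter.EventuallyEq.rfl⟩

theorem VanishesToOrder.add {S : Set V} {p : ℤ} {f g : C^∞⟮I, V; ℝ⟯}
    (hf : VanishesToOrder I S p f) (hg : VanishesToOrder I S p g) :
    VanishesToOrder I S p (f + g) := by
  intro v
  obtain ⟨f', hf', hff'⟩ := hf v
  obtain ⟨g', hg', hgg'⟩ := hg v
  refine ⟨f' + g', Ideal.add_mem _ hf' hg', ?_⟩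
  simpa using hff'.add hgg'

theorem VanishesToOrder.mul {S : Set V} {p q r : ℤ} {f g : C^∞⟮I, V; ℝ⟯}
    (hf : VanishesToOrder I S p f) (hg : VanishesToOrder I S q g) (hr : r = p + q) :
    VanishesToOrder I S r (f * g) := by
  intro v
  obtain ⟨f', hf', hff'⟩ := hf v
  obtain ⟨g', hg', hgg'⟩ := hg v
  refine ⟨f' * g', ?_, ?_⟩
  · have h : f' * g' ∈ (smoothVanishingIdeal I S) ^ (p.toNat + q.toNat) := by
      rw [pow_add]
      exact Ideal.mul_mem_mul hf' hg'
    exact Ideal.pow_le_pow_right (by omega) h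
  · simpa using hff'.mul hgg'

theorem VanishesToOrder.of_nonpos (S : Set V) {p : ℤ} (hp : p ≤ 0) (f : C^∞⟮I, V; ℝ⟯) :
    VanishesToOrder I S p f := by
  intro v
  refine ⟨f, ?_, Filter.EventuallyEq.rfl⟩
  rw [Int.toNat_of_nonpos hp, pow_zero, Ideal.one_eq_top]
  trivial

variable (I)

/-- The algebra `A(V, S)` of the Laurent polynomials `∑ f_p t^{-p}` with coefficients in `C^∞(V)`
such that `f_p` vanishes to order `p` or more on `S` for every `p`. -/
def deformationAlgebra (S : Set V) : Subalgebra ℝ (C^∞⟮I, V; ℝ⟯[T;T⁻¹]) where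
  carrier := {a | ∀ p : ℤ, VanishesToOrder I S p (a.coeff (-p))}
  add_mem' := by
    intro a b ha hb p
    simpa using (ha p).add (hb p)
  mul_mem' := by
    intro a b ha hb p
    rw [AddMonoidAlgebra.coeff_mul]
    refine Finset.sum_induction _ (VanishesToOrder I S p) (fun _ _ => VanishesToOrder.add)
      (VanishesToOrder.zero S p) fun i _ => ?_
    refine Finset.sum_induction _ (VanishesToOrder I S p) (fun _ _ => VanishesToOrder.add)
      (VanishesToOrder.zero S p) fun j _ => ?_
    dsimp only
    split_ifs with hij
    · have hi := ha (-i)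
      have hj := hb (-j)
      rw [neg_neg] at hi hj
      exact hi.mul hj (by omega)
    · exact VanishesToOrder.zero S p
  algebraMap_mem' := by
    intro r p
    rcases le_or_gt p 0 with hp | hp
    · exact VanishesToOrder.of_nonpos S hp _
    · have h : ((algebraMap ℝ (C^∞⟮I, V; ℝ⟯[T;T⁻¹]) r).coeff (-p)) = 0 := by
        rw [LaurentPolynomial.algebraMap_apply, LaurentPolynomial.C_apply]
        rw [if_neg (by omega)]
      rw [h]
      exact VanishesToOrder.zero S p

end DeformationAlgebra

/-! ### The tangent groupoid -/

section TangentGroupoid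

/-- The tangent groupoid `𝕋M = TM × {0} ⊔ M × M × ℝˣ`. -/
inductive TangentGroupoid (n : ℕ) (M : Type u) [TopologicalSpace M]
    [ChartedSpace (EuclideanSpace ℝ (Fin n)) M] : Type u
  | tangent (m : M) (X : TangentSpace (𝓡 n) m) : TangentGroupoid n M
  | pair (m₁ m₂ : M) (l : ℝ) (hl : l ≠ 0) : TangentGroupoid n M

variable {n : ℕ} {M : Type u} [TopologicalSpace M] [ChartedSpace (EuclideanSpace ℝ (Fin n)) M]

/-- The coordinate algebra `A(𝕋M) = A(M × M, M)` of the diagonal embedding. -/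
abbrev tangentAlgebra (n : ℕ) (M : Type u) [TopologicalSpace M]
    [ChartedSpace (EuclideanSpace ℝ (Fin n)) M] :
    Subalgebra ℝ (C^∞⟮(𝓡 n).prod (𝓡 n), M × M; ℝ⟯[T;T⁻¹]) :=
  deformationAlgebra ((𝓡 n).prod (𝓡 n)) (Set.diagonal M)

namespace TangentGroupoid

/-- The iterated derivative `Z^p f` at `(m, m)` of a function on `M × M`, where `Z` is the vector
field extending the tangent vector `(X, 0)` at `(m, m)` that is constant in the coordinates
centred there. For `f` vanishing to order `p` on the diagonal the value does not depend on the
extension, and depends only on the class of `(X, 0)` in the normal space of the diagonal. -/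
def iteratedDerivAlong (p : ℕ) (f : M × M → ℝ) (m : M) (X : TangentSpace (𝓡 n) m) : ℝ :=
  iteratedFDeriv ℝ p (f ∘ (extChartAt ((𝓡 n).prod (𝓡 n)) (m, m)).symm)
    (extChartAt ((𝓡 n).prod (𝓡 n)) (m, m) (m, m))
    (fun _ => ((X, 0) : EuclideanSpace ℝ (Fin n) × EuclideanSpace ℝ (Fin n)))

/-- The characters of `A(𝕋M)` given by the points of `𝕋M`. On `a = ∑ f_p t^{-p}` (so that `f_p` is
the coefficient of index `-p`) the point `(m₁, m₂, λ)` takes the value `∑ f_p(m₁, m₂) λ^{-p}`, and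
the tangent vector `X` at `m`, standing for the normal vector `(X, 0)` of the diagonal, takes the
value `∑_{p ≥ 0} (1/p!) X^p(f_p)`. -/
def eval (a : tangentAlgebra n M) : TangentGroupoid n M → ℝ
  | tangent m X => (a : C^∞⟮(𝓡 n).prod (𝓡 n), M × M; ℝ⟯[T;T⁻¹]).coeff.sum fun i f =>
      if i ≤ 0 then
        ((-i).toNat.factorial : ℝ)⁻¹ * iteratedDerivAlong (-i).toNat (f : M × M → ℝ) m X
      else 0
  | pair m₁ m₂ l _ => (a : C^∞⟮(𝓡 n).prod (𝓡 n), M × M; ℝ⟯[T;T⁻¹]).coeff.sum fun i f =>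
      f (m₁, m₂) * l ^ i

/-- The weak topology: the coarsest one for which the evaluations of the elements of `A(𝕋M)` are
continuous. -/
instance : TopologicalSpace (TangentGroupoid n M) :=
  ⨅ a : tangentAlgebra n M, TopologicalSpace.induced (eval a) inferInstance

theorem continuous_eval (a : tangentAlgebra n M) : Continuous (eval a) :=
  continuous_iInf_dom continuous_induced_dom

/-- Smooth functions on `𝕋M`: those that are locally of the form `h(a₁, …, a_k)` with
`a₁, …, a_k ∈ A(𝕋M)` and `h` smooth on `ℝ^k`. -/
def IsSmooth (f : TangentGroupoid n M → ℝ) : Prop :=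
  ∀ γ : TangentGroupoid n M, ∃ (k : ℕ) (a : Fin k → tangentAlgebra n M) (h : (Fin k → ℝ) → ℝ),
    ContDiff ℝ ∞ h ∧ ∀ᶠ η in 𝓝 γ, f η = h (fun j => eval (a j) η)

/-- The source map `𝕋M → M × ℝ`. -/
def source : TangentGroupoid n M → M × ℝ
  | tangent m _ => (m, 0)
  | pair _ m₂ l _ => (m₂, l)

/-- The target map `𝕋M → M × ℝ`. -/
def target : TangentGroupoid n M → M × ℝ
  | tangent m _ => (m, 0)
  | pair m₁ _ l _ => (m₁, l)

/-- The composition law of composable elements: `(m₁, m₂, λ) ∘ (m₂, m₃, λ) = (m₁, m₃, λ)` and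
`X ∘ Y = X + Y` for tangent vectors at the same point. -/
def comp : (γ η : TangentGroupoid n M) → source γ = target η → TangentGroupoid n M
  | tangent m X, tangent m' Y, h =>
      tangent m (X + (show m' = m from (congrArg Prod.fst h).symm) ▸ Y)
  | pair m₁ _ l hl, pair _ m₃ _ _, _ => pair m₁ m₃ l hl
  | tangent _ _, pair _ _ _ hl, h => absurd (congrArg Prod.snd h).symm hl
  | pair _ _ _ hl, tangent _ _, h => absurd (congrArg Prod.snd h) hl

theorem source_comp (γ η : TangentGroupoid n M) (h : source γ = target η) :
    source (comp γ η h) = source η := by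
  rcases γ with ⟨m, X⟩ | ⟨m₁, m₂, l, hl⟩ <;> rcases η with ⟨m', Y⟩ | ⟨m₁', m₂', l', hl'⟩
  · exact h
  · exact absurd (congrArg Prod.snd h).symm hl'
  · exact absurd (congrArg Prod.snd h) hl
  · exact Prod.ext rfl (show l = l' from congrArg Prod.snd h)

/-! ### Source fibers -/

/-- The source fiber `𝕋M_x` over `x ∈ M × ℝ`. -/
def SourceFiber (n : ℕ) {M : Type u} [TopologicalSpace M]
    [ChartedSpace (EuclideanSpace ℝ (Fin n)) M] (x : M × ℝ) : Type u :=
  {γ : TangentGroupoid n M // source γ = x}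

/-- The identification `M → 𝕋M_{(m, λ)}`, `m₁ ↦ (m₁, m, λ)`, for `λ ≠ 0`. -/
def pairPoint (x : M × ℝ) (hx : x.2 ≠ 0) (m₁ : M) : SourceFiber n x :=
  ⟨pair m₁ x.1 x.2 hx, rfl⟩

/-- The identification `T_m M → 𝕋M_{(m, 0)}`, `X ↦ X`. -/
def tangentPoint (x : M × ℝ) (hx : x.2 = 0) (X : TangentSpace (𝓡 n) x.1) : SourceFiber n x :=
  ⟨tangent x.1 X, Prod.ext rfl hx.symm⟩

theorem pairPoint_bijective (x : M × ℝ) (hx : x.2 ≠ 0) :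
    Function.Bijective (pairPoint (n := n) x hx) := by
  constructor
  · intro m m' h
    simpa [pairPoint] using congrArg Subtype.val h
  · rintro ⟨⟨m, X⟩ | ⟨m₁, m₂, l, hl⟩, rfl⟩
    · exact absurd rfl hx
    · exact ⟨m₁, rfl⟩

theorem tangentPoint_bijective (x : M × ℝ) (hx : x.2 = 0) :
    Function.Bijective (tangentPoint (n := n) x hx) := by
  constructor
  · intro X X' h
    simpa [tangentPoint] using congrArg Subtype.val h
  · rintro ⟨⟨m, X⟩ | ⟨m₁, m₂, l, hl⟩, rfl⟩
    · exact ⟨X, rfl⟩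
    · exact absurd hx hl

/-- The smooth functions on the source fiber over `x = (m, λ)`, identified with `M` if `λ ≠ 0` and
with the vector space `T_m M` if `λ = 0`. -/
def fiberSmooth (n : ℕ) {M : Type u} [TopologicalSpace M]
    [ChartedSpace (EuclideanSpace ℝ (Fin n)) M] (x : M × ℝ) :
    Submodule ℝ (SourceFiber n x → ℝ) where
  carrier := {f |
    (∀ hx : x.2 ≠ 0, ContMDiff (𝓡 n) 𝓘(ℝ, ℝ) ∞ fun m₁ : M => f (pairPoint x hx m₁)) ∧
    (∀ hx : x.2 = 0, ContMDiff (𝓡 n) 𝓘(ℝ, ℝ) ∞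
      fun X : EuclideanSpace ℝ (Fin n) => f (tangentPoint x hx X))}
  add_mem' := fun {_ _} hf hg =>
    ⟨fun hx => (hf.1 hx).add (hg.1 hx), fun hx => (hf.2 hx).add (hg.2 hx)⟩
  zero_mem' := ⟨fun _ => contMDiff_const, fun _ => contMDiff_const⟩
  smul_mem' := fun c _ hf =>
    ⟨fun hx => (contMDiff_const (c := c)).mul (hf.1 hx),
      fun hx => (contMDiff_const (c := c)).mul (hf.2 hx)⟩

/-- For `λ ≠ 0`, the smooth functions on the source fiber over `(m, λ)` are those on `M`. -/
def fiberSmoothPair (x : M × ℝ) (hx : x.2 ≠ 0) : fiberSmooth n x ≃ₗ[ℝ] C^∞⟮𝓡 n, M; ℝ⟯ where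
  toFun f := ⟨fun m₁ => f.1 (pairPoint x hx m₁), f.2.1 hx⟩
  invFun g := ⟨fun γ => g ((Equiv.ofBijective _ (pairPoint_bijective x hx)).symm γ), by
    refine ⟨fun _ => ?_, fun hx' => absurd hx' hx⟩
    have h : (fun m₁ : M => g ((Equiv.ofBijective _ (pairPoint_bijective (n := n) x hx)).symm
        (pairPoint x hx m₁))) = g := by
      funext m₁
      exact congrArg g ((Equiv.ofBijective _ (pairPoint_bijective x hx)).symm_apply_apply m₁)
    rw [h]
    exact g.contMDiff⟩
  left_inv f := by
    apply Subtype.ext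
    funext γ
    exact congrArg f.1 ((Equiv.ofBijective _ (pairPoint_bijective x hx)).apply_symm_apply γ)
  right_inv g := by
    ext m₁
    exact congrArg g ((Equiv.ofBijective _ (pairPoint_bijective x hx)).symm_apply_apply m₁)
  map_add' _ _ := rfl
  map_smul' _ _ := rfl

/-- The smooth functions on the source fiber over `(m, 0)` are those on `T_m M`, which is the
vector space `ℝⁿ` by means of the preferred coordinates at `m`. -/
def fiberSmoothTangent (x : M × ℝ) (hx : x.2 = 0) :
    fiberSmooth n x ≃ₗ[ℝ] C^∞⟮𝓡 n, EuclideanSpace ℝ (Fin n); ℝ⟯ where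
  toFun f := ⟨fun X => f.1 (tangentPoint x hx X), f.2.2 hx⟩
  invFun g := ⟨fun γ => g ((Equiv.ofBijective _ (tangentPoint_bijective (n := n) x hx)).symm γ), by
    refine ⟨fun hx' => absurd hx hx', fun _ => ?_⟩
    have h : (fun X : EuclideanSpace ℝ (Fin n) =>
        g ((Equiv.ofBijective _ (tangentPoint_bijective (n := n) x hx)).symm
        (tangentPoint x hx X))) = g := by
      funext X
      exact congrArg g ((Equiv.ofBijective _ (tangentPoint_bijective (n := n) x hx)).symm_apply_apply X)
    rw [h]
    exact g.contMDiff⟩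
  left_inv f := by
    apply Subtype.ext
    funext γ
    exact congrArg f.1 ((Equiv.ofBijective _ (tangentPoint_bijective x hx)).apply_symm_apply γ)
  right_inv g := by
    ext X
    exact congrArg g ((Equiv.ofBijective _ (tangentPoint_bijective (n := n) x hx)).symm_apply_apply X)
  map_add' _ _ := rfl
  map_smul' _ _ := rfl

/-! ### Restriction to source fibers and right translation -/

theorem IsSmooth.contMDiff_comp {E' H' N : Type*} [NormedAddCommGroup E'] [NormedSpace ℝ E']
    [TopologicalSpace H'] {J : ModelWithCorners ℝ E' H'} [TopologicalSpace N] [ChartedSpace H' N]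
    {f : TangentGroupoid n M → ℝ} (hf : IsSmooth f) {c : N → TangentGroupoid n M}
    (hc : ∀ a : tangentAlgebra n M, ContMDiff J 𝓘(ℝ, ℝ) ∞ fun x => eval a (c x)) :
    ContMDiff J 𝓘(ℝ, ℝ) ∞ fun x => f (c x) := by
  have hcont : Continuous c :=
    continuous_iInf_rng.2 fun a => continuous_induced_rng.2 (hc a).continuous
  intro x
  obtain ⟨k, a, h, hh, hev⟩ := hf (c x)
  have h1 : ContMDiff J 𝓘(ℝ, ℝ) ∞ fun y => h (fun j => eval (a j) (c y)) :=
    hh.contMDiff.comp (contMDiff_pi_space.2 fun j => hc (a j))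
  exact (h1 x).congr_of_eventuallyEq (hcont.continuousAt.eventually hev)

theorem contMDiff_eval_pair (a : tangentAlgebra n M) (m₂ : M) (l : ℝ) (hl : l ≠ 0) :
    ContMDiff (𝓡 n) 𝓘(ℝ, ℝ) ∞ fun m₁ : M => eval a (pair m₁ m₂ l hl) := by
  refine ContMDiff.sum fun i _ => ?_
  refine ContMDiff.mul ?_ contMDiff_const
  exact (ContMDiffMap.contMDiff _).comp (contMDiff_id.prodMk contMDiff_const)

theorem contMDiff_eval_tangent (a : tangentAlgebra n M) (m : M) :
    ContMDiff (𝓡 n) 𝓘(ℝ, ℝ) ∞ fun X : EuclideanSpace ℝ (Fin n) => eval a (tangent m X) := by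
  refine ContMDiff.sum fun i _ => ?_
  by_cases hi : i ≤ 0
  · simp only [hi, if_true]
    refine ContMDiff.mul contMDiff_const ?_
    refine ContDiff.contMDiff ?_
    refine (ContinuousMultilinearMap.contDiff _).comp ?_
    exact contDiff_pi.2 fun _ => contDiff_id.prodMk contDiff_const
  · simp only [hi, if_false]
    exact contMDiff_const

/-- The restriction of a smooth function on `𝕋M` to a source fiber. -/
def restrict (f : TangentGroupoid n M → ℝ) (hf : IsSmooth f) (x : M × ℝ) : fiberSmooth n x :=
  ⟨fun γ => f γ.1, fun hx => hf.contMDiff_comp fun a => contMDiff_eval_pair a x.1 x.2 hx,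
    fun _ => hf.contMDiff_comp fun a => contMDiff_eval_tangent a x.1⟩

/-- Right translation `η ↦ η ∘ γ`, from the source fiber over the target of `γ` to the source fiber
over the source of `γ`. -/
def rightMul (γ : TangentGroupoid n M) (η : SourceFiber n (target γ)) :
    SourceFiber n (source γ) :=
  ⟨comp η.1 γ η.2, source_comp η.1 γ η.2⟩

/-- The pullback of smooth functions by right translation. -/
def pullbackRight (γ : TangentGroupoid n M) :
    fiberSmooth n (source γ) →ₗ[ℝ] fiberSmooth n (target γ) where
  toFun f := ⟨fun η => f.1 (rightMul γ η), by
    rcases γ with ⟨m, X⟩ | ⟨m₁, m₂, l, hl⟩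
    · refine ⟨fun hx => absurd rfl hx, fun hx => ?_⟩
      have h : ContMDiff (𝓡 n) (𝓡 n) ∞
          fun Y : EuclideanSpace ℝ (Fin n) => Y + (show EuclideanSpace ℝ (Fin n) from X) :=
        contMDiff_id.add contMDiff_const
      exact (f.2.2 hx).comp h
    · exact ⟨fun hx => f.2.1 hx, fun hx => absurd hx hl⟩⟩
  map_add' _ _ := rfl
  map_smul' _ _ := rfl

end TangentGroupoid

/-! ### Differential operators and their model operators -/

/-- `D = ∑_{k ≤ q} ∑_{w₁, …, w_k} a^{w₁ ⋯ w_k} ∂_{w₁} ⋯ ∂_{w_k}` in the local coordinates `φ`, with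
smooth coefficients. -/
def HasLocalExpression (q : ℕ) (D : C^∞⟮𝓡 n, M; ℝ⟯ →ₗ[ℝ] C^∞⟮𝓡 n, M; ℝ⟯)
    (φ : OpenPartialHomeomorph M (EuclideanSpace ℝ (Fin n)))
    (a : (k : ℕ) → (Fin k → Fin n) → EuclideanSpace ℝ (Fin n) → ℝ) : Prop :=
  (∀ k ≤ q, ∀ w : Fin k → Fin n, ContDiffOn ℝ ∞ (a k w) φ.target) ∧
  ∀ f : C^∞⟮𝓡 n, M; ℝ⟯, ∀ m ∈ φ.source,
    D f m = ∑ k ∈ Finset.range (q + 1), ∑ w : Fin k → Fin n,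
      a k w (φ m) * iteratedFDeriv ℝ k (f ∘ φ.symm) (φ m) fun j => EuclideanSpace.single (w j) 1

/-- `D` is a linear partial differential operator of order (at most) `q`. -/
def IsDiffOp (q : ℕ) (D : C^∞⟮𝓡 n, M; ℝ⟯ →ₗ[ℝ] C^∞⟮𝓡 n, M; ℝ⟯) : Prop :=
  ∀ m : M, ∃ a, HasLocalExpression q D (chartAt (EuclideanSpace ℝ (Fin n)) m) a

/-- The coordinate vector `∂/∂x_i` of the local coordinates `φ` at `m`, an element of `T_m M`. -/
def coordVector (φ : OpenPartialHomeomorph M (EuclideanSpace ℝ (Fin n))) (m : M) (i : Fin n) :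
    EuclideanSpace ℝ (Fin n) :=
  mfderiv (𝓡 n) (𝓡 n) φ.symm (φ m) (EuclideanSpace.single i (1 : ℝ) : EuclideanSpace ℝ (Fin n))

/-- The constant coefficient operator on `T_m M` obtained from a local coordinate expression of
order `q` by freezing the coefficients at `m` and dropping the terms of order less than `q`:
`∑_{w₁, …, w_q} a^{w₁ ⋯ w_q}(m) ∂_{w₁} ⋯ ∂_{w_q}`, where `∂_i` is now the directional derivative
on `T_m M` along the coordinate vector at `m`. -/
def frozenOperator (q : ℕ) (φ : OpenPartialHomeomorph M (EuclideanSpace ℝ (Fin n)))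
    (a : (k : ℕ) → (Fin k → Fin n) → EuclideanSpace ℝ (Fin n) → ℝ) (m : M) :
    C^∞⟮𝓡 n, EuclideanSpace ℝ (Fin n); ℝ⟯ →ₗ[ℝ] C^∞⟮𝓡 n, EuclideanSpace ℝ (Fin n); ℝ⟯ where
  toFun g := ⟨fun v => ∑ w : Fin q → Fin n,
      a q w (φ m) * iteratedFDeriv ℝ q g v fun j => coordVector φ m (w j), by
    refine ContDiff.contMDiff (ContDiff.sum fun w _ => contDiff_const.mul ?_)
    have h : ContDiff ℝ ∞ (iteratedFDeriv ℝ q g) :=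
      ContDiff.iteratedFDeriv_right (m := ∞) g.contMDiff.contDiff (by norm_cast)
    exact (ContinuousMultilinearMap.apply ℝ (fun _ : Fin q => EuclideanSpace ℝ (Fin n)) ℝ
      fun j => coordVector φ m (w j)).contDiff.comp h⟩
  map_add' g₁ g₂ := by
    ext v
    have h₁ : ContDiffAt ℝ q g₁ v := (contMDiff_iff_contDiff.1 g₁.contMDiff).contDiffAt.of_le
      (by exact_mod_cast le_top)
    have h₂ : ContDiffAt ℝ q g₂ v := (contMDiff_iff_contDiff.1 g₂.contMDiff).contDiffAt.of_le
      (by exact_mod_cast le_top)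
    have h : iteratedFDeriv ℝ q (g₁ + g₂ : C^∞⟮𝓡 n, EuclideanSpace ℝ (Fin n); ℝ⟯) v
        = iteratedFDeriv ℝ q g₁ v + iteratedFDeriv ℝ q g₂ v := iteratedFDeriv_add_apply h₁ h₂
    change ∑ w : Fin q → Fin n, _ =
      (∑ w : Fin q → Fin n, (_ : ℝ)) + ∑ w : Fin q → Fin n, (_ : ℝ)
    rw [h, ← Finset.sum_add_distrib]
    exact Finset.sum_congr rfl fun w _ => mul_add _ _ _
  map_smul' c g := by
    ext v
    have h₁ : ContDiffAt ℝ q g v := (contMDiff_iff_contDiff.1 g.contMDiff).contDiffAt.of_le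
      (by exact_mod_cast le_top)
    have h : iteratedFDeriv ℝ q (c • g : C^∞⟮𝓡 n, EuclideanSpace ℝ (Fin n); ℝ⟯) v
        = c • iteratedFDeriv ℝ q g v := iteratedFDeriv_const_smul_apply h₁
    change ∑ w : Fin q → Fin n, _ = c * ∑ w : Fin q → Fin n, (_ : ℝ)
    rw [h, Finset.mul_sum]
    exact Finset.sum_congr rfl fun w _ => mul_left_comm _ _ _

/-- The model operator `D_m` on `T_m M`, by means of the preferred coordinates at `m`. -/
def modelOperator {q : ℕ} {D : C^∞⟮𝓡 n, M; ℝ⟯ →ₗ[ℝ] C^∞⟮𝓡 n, M; ℝ⟯} (hD : IsDiffOp q D) (m : M) :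
    C^∞⟮𝓡 n, EuclideanSpace ℝ (Fin n); ℝ⟯ →ₗ[ℝ] C^∞⟮𝓡 n, EuclideanSpace ℝ (Fin n); ℝ⟯ :=
  frozenOperator q (chartAt (EuclideanSpace ℝ (Fin n)) m) (hD m).choose m

/-! ### Families of operators on the source fibers -/

namespace TangentGroupoid

/-- The family `D_{(m, λ)}` on the source fibers: `λ^q D` for `λ ≠ 0`, and `D_m` for `λ = 0`. -/
def operatorFamily {q : ℕ} {D : C^∞⟮𝓡 n, M; ℝ⟯ →ₗ[ℝ] C^∞⟮𝓡 n, M; ℝ⟯} (hD : IsDiffOp q D)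
    (x : M × ℝ) : fiberSmooth n x →ₗ[ℝ] fiberSmooth n x :=
  open Classical in
  if hx : x.2 = 0 then (fiberSmoothTangent x hx).symm.conj (modelOperator hD x.1)
  else (fiberSmoothPair x hx).symm.conj (x.2 ^ q • D)

/-- An operator on a source fiber is a differential operator of order at most `q`. -/
def IsFiberDiffOp (q : ℕ) (x : M × ℝ) (P : fiberSmooth n x →ₗ[ℝ] fiberSmooth n x) : Prop :=
  (∀ hx : x.2 ≠ 0, IsDiffOp q ((fiberSmoothPair x hx).conj P)) ∧
  (∀ hx : x.2 = 0, IsDiffOp q ((fiberSmoothTangent x hx).conj P))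

/-- The result of applying a family of operators fiberwise to a smooth function on `𝕋M`. -/
def applyFamily (P : (x : M × ℝ) → fiberSmooth n x →ₗ[ℝ] fiberSmooth n x)
    (f : TangentGroupoid n M → ℝ) (hf : IsSmooth f) (γ : TangentGroupoid n M) : ℝ :=
  (P (source γ) (restrict f hf (source γ))).1 ⟨γ, rfl⟩

/-- A smooth family of differential operators of order at most `q` on the source fibers: applied
fiberwise, it takes smooth functions on `𝕋M` to smooth functions on `𝕋M`. -/
structure IsSmoothFamily (q : ℕ) (P : (x : M × ℝ) → fiberSmooth n x →ₗ[ℝ] fiberSmooth n x) :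
    Prop where
  isFiberDiffOp : ∀ x, IsFiberDiffOp q x (P x)
  isSmooth_apply : ∀ (f : TangentGroupoid n M → ℝ) (hf : IsSmooth f), IsSmooth (applyFamily P f hf)

/-- Equivariance for the right action of `𝕋M` on itself: the family commutes with the pullback
along every right translation `𝕋M_{target γ} → 𝕋M_{source γ}`. -/
def IsEquivariantFamily (P : (x : M × ℝ) → fiberSmooth n x →ₗ[ℝ] fiberSmooth n x) : Prop :=
  ∀ (γ : TangentGroupoid n M) (f : fiberSmooth n (source γ)),
    P (target γ) (pullbackRight γ f) = pullbackRight γ (P (source γ) f)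

end TangentGroupoid

end TangentGroupoid

end

noncomputable section

universe u

/-! ### Iterated derivatives and vanishing to finite order in normed spaces -/

section Analysis

variable {E F G : Type*} [NormedAddCommGroup E] [NormedSpace ℝ E] [NormedAddCommGroup F]
  [NormedSpace ℝ F] [NormedAddCommGroup G] [NormedSpace ℝ G]

/-! The operator `D_m` is the leading behaviour of `D` under rescaling. If `F` vanishes to order `p`
at `x`, then `s^{-(p-k)}` times its `k`-th derivative at `x + s X` tends to the `k`-th derivative at
`X` of its Taylor term of degree `p` (`FlatAt.tendsto_iteratedFDeriv`). In `s^{-(p-q)} D f` the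
terms of order `k` thus keep a factor `s^{q-k}`, and only those of order `q`, with frozen
coefficients, survive as `s → 0` (`IsDiffOp.tendsto_modelOperator`).

Independence of coordinates: on a function flat to order `q` at `m` only the top coefficients of `D`
act, and a change of coordinates acts on the `q`-th derivative through its linear part. Hence `D_m
g` at `v` is `D f` at `m`, for any `f` that near `m` is the Taylor term of degree `q` of `g` at `v`
in the preferred chart; no local expression enters this value (`frozenOperator_apply_eq`).

Smoothness: on `A(𝕋M)` the family acts by `f t^{-p} ↦ (D ⊗ 1) f t^{-(p-q)}`. This stays in the
algebra because `D ⊗ 1` lowers the order of vanishing on the diagonal by at most `q`, which follows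
algebraically from its iterated commutators with functions (`HasCommutatorOrder.map_mem_pow`). Off
the zero fibers the formula is immediate, and on tangent vectors it is obtained in the limit
(`exists_eval_eq_apply`). For `h(a₁, …, a_k)`, the Taylor polynomial of `h` of degree `q` reduces
the operator to derivatives of `h`, the functions `a_j`, and the operator applied to products of the
`a_j` (`IsDiffOp.apply_comp`). The resulting formula is the same on all fibers, and each of its
ingredients is smooth on `𝕋M` (`applyFamily_eq_sum`).

Equivariance: for `λ ≠ 0` right translation is the identity of `M`; for `λ = 0` it is a translation
of `T_m M`, with which constant coefficient operators commute. -/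

theorem iteratedFDeriv_comp_swap {n : ℕ} {f : E → F} {x : E} (hf : ContDiffAt ℝ (n + 1 : ℕ) f x)
    (i : Fin n) (v : Fin (n + 1) → E) :
    iteratedFDeriv ℝ (n + 1) f x (v ∘ Equiv.swap i.castSucc i.succ)
      = iteratedFDeriv ℝ (n + 1) f x v := by
  induction n generalizing x with
  | zero => exact i.elim0
  | succ n ih =>
    have hd : ∀ᶠ y in 𝓝 x, ContDiffAt ℝ (n + 1 + 1 : ℕ) f y := hf.eventually (by simp)
    induction i using Fin.cases with
    -- The first swap exchanges the two outermost differentiations, so it is the symmetry of the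
    -- second derivative of the `n`-th one.
    | zero =>
      have hdn : ContDiffAt ℝ 2 (iteratedFDeriv ℝ n f) x :=
        hf.iteratedFDeriv_right (by norm_cast; omega)
      have hsymm : IsSymmSndFDerivAt ℝ (iteratedFDeriv ℝ n f) x :=
        hdn.isSymmSndFDerivAt (by simp)
      have key : ∀ w : Fin (n + 1 + 1) → E, iteratedFDeriv ℝ (n + 1 + 1) f x w
          = fderiv ℝ (fderiv ℝ (iteratedFDeriv ℝ n f)) x (w 0) (w 1) (Fin.tail (Fin.tail w)) := by
        intro w
        have hdiff : DifferentiableAt ℝ (iteratedFDeriv ℝ (n + 1) f) x :=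
          (hf.iteratedFDeriv_right (m := 1) (by norm_cast; omega)).differentiableAt (by simp)
        have hd2 : DifferentiableAt ℝ (fderiv ℝ (iteratedFDeriv ℝ n f)) x :=
          (hdn.fderiv_right (m := 1) (by norm_num)).differentiableAt (by simp)
        rw [hdiff.iteratedFDeriv_succ_apply_left']
        have hd3 : DifferentiableAt ℝ (fun y => fderiv ℝ (iteratedFDeriv ℝ n f) y (w 1)) x :=
          hd2.clm_apply (differentiableAt_const _)
        change fderiv ℝ (fun y => fderiv ℝ (iteratedFDeriv ℝ n f) y (w 1)
          (Fin.tail (Fin.tail w))) x (w 0) = _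
        rw [fderiv_continuousMultilinear_apply_const hd3,
          fderiv_clm_apply hd2 (differentiableAt_const _)]
        simp
      rw [key, key, hsymm.eq]
      have h0 : (v ∘ Equiv.swap (Fin.castSucc 0) (Fin.succ 0)) 0 = v 1 := by simp
      have h1 : (v ∘ Equiv.swap (Fin.castSucc 0) (Fin.succ 0)) 1 = v 0 := by simp
      rw [h0, h1]
      congr 1
    -- A later swap leaves the outermost slot alone: the inductive hypothesis holds at all points
    -- near `x` and can be differentiated.
    | succ j =>
      have hdiff : DifferentiableAt ℝ (iteratedFDeriv ℝ (n + 1) f) x :=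
        (hf.iteratedFDeriv_right (m := 1) (by norm_cast; omega)).differentiableAt (by simp)
      rw [hdiff.iteratedFDeriv_succ_apply_left', hdiff.iteratedFDeriv_succ_apply_left']
      have h0 : (v ∘ Equiv.swap j.succ.castSucc j.succ.succ) 0 = v 0 := by
        rw [Function.comp_apply, Equiv.swap_apply_of_ne_of_ne]
        · simp [Fin.ext_iff]
        · simp [Fin.ext_iff]
      have ht : Fin.tail (v ∘ Equiv.swap j.succ.castSucc j.succ.succ)
          = Fin.tail v ∘ Equiv.swap j.castSucc j.succ := by
        funext k
        simp only [Fin.tail, Function.comp_apply]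
        congr 1
        rw [← Fin.succ_castSucc, (Fin.succ_injective _).swap_apply]
      rw [h0, ht]
      congr 1
      refine Filter.EventuallyEq.fderiv_eq ?_
      filter_upwards [hd] with y hy
      exact ih (hy.of_le (by norm_cast; omega)) j _

theorem iteratedFDeriv_comp_perm {n : ℕ} {f : E → F} {x : E} (hf : ContDiffAt ℝ n f x)
    (σ : Equiv.Perm (Fin n)) (v : Fin n → E) :
    iteratedFDeriv ℝ n f x (v ∘ σ) = iteratedFDeriv ℝ n f x v := by
  cases n with
  | zero => congr 1; exact Subsingleton.elim _ _
  | succ n =>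
    have hσ : σ ∈ Submonoid.closure
        (Set.range fun i : Fin n => Equiv.swap i.castSucc i.succ) := by
      rw [Equiv.Perm.mclosure_swap_castSucc_succ]; trivial
    induction hσ using Submonoid.closure_induction generalizing v with
    | mem τ hτ =>
      obtain ⟨i, rfl⟩ := hτ
      exact iteratedFDeriv_comp_swap hf i v
    | one => rfl
    | mul τ τ' _ _ h h' =>
      rw [Equiv.Perm.coe_mul, ← Function.comp_assoc, h', h]

/-- The derivatives of `f` of order less than `p` vanish at `x`. -/
def FlatAt (p : ℕ) (f : E → F) (x : E) : Prop :=
  ∀ j < p, iteratedFDeriv ℝ j f x = 0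

theorem FlatAt.congr {p : ℕ} {f g : E → F} {x : E} (hf : FlatAt p f x) (h : g =ᶠ[𝓝 x] f) :
    FlatAt p g x := fun j hj => by
  rw [(h.iteratedFDeriv ℝ j).eq_of_nhds, hf j hj]

theorem FlatAt.mono {p q : ℕ} {f : E → F} {x : E} (hf : FlatAt p f x) (h : q ≤ p) :
    FlatAt q f x := fun j hj => hf j (hj.trans_le h)

theorem FlatAt.add {p : ℕ} {f g : E → F} {x : E} (hfx : ContDiffAt ℝ ∞ f x)
    (hgx : ContDiffAt ℝ ∞ g x) (hf : FlatAt p f x) (hg : FlatAt p g x) :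
    FlatAt p (f + g) x := fun j hj => by
  rw [iteratedFDeriv_add_apply (hfx.of_le (by exact_mod_cast le_top))
    (hgx.of_le (by exact_mod_cast le_top)), hf j hj, hg j hj, add_zero]

theorem exists_isOpen_contDiffOn {N : ℕ} {f : E → F} {x : E} (hf : ContDiffAt ℝ N f x) :
    ∃ U, IsOpen U ∧ x ∈ U ∧ ContDiffOn ℝ N f U := by
  obtain ⟨U, hU, hfU⟩ := hf.contDiffOn le_rfl (by simp)
  obtain ⟨V, hVU, hV, hxV⟩ := mem_nhds_iff.1 hU
  exact ⟨V, hV, hxV, hfU.mono (by simpa using hVU)⟩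

theorem FlatAt.mul {p q : ℕ} {f g : E → ℝ} {x : E} (hfx : ContDiffAt ℝ ∞ f x)
    (hgx : ContDiffAt ℝ ∞ g x) (hf : FlatAt p f x) (hg : FlatAt q g x) :
    FlatAt (p + q) (fun y => f y * g y) x := by
  intro j hj
  obtain ⟨U, hU, hxU, hfU⟩ := exists_isOpen_contDiffOn (N := j)
    (hfx.of_le (by exact_mod_cast le_top))
  obtain ⟨V, hV, hxV, hgV⟩ := exists_isOpen_contDiffOn (N := j)
    (hgx.of_le (by exact_mod_cast le_top))
  have hUV : IsOpen (U ∩ V) := hU.inter hV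
  have hx : x ∈ U ∩ V := ⟨hxU, hxV⟩
  -- The norm form of the Leibniz rule suffices: in each term either `i < p` or `j - i < q`.
  have h := norm_iteratedFDerivWithin_mul_le (hfU.mono Set.inter_subset_left)
    (hgV.mono Set.inter_subset_right) hUV.uniqueDiffOn hx (n := j) le_rfl
  rw [iteratedFDerivWithin_of_isOpen _ hUV hx] at h
  refine norm_le_zero_iff.1 (h.trans (le_of_eq ?_))
  refine Finset.sum_eq_zero fun i hi => ?_
  rw [Finset.mem_range] at hi
  rw [iteratedFDerivWithin_of_isOpen _ hUV hx, iteratedFDerivWithin_of_isOpen _ hUV hx]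
  rcases lt_or_ge i p with h' | h'
  · simp [hf i h']
  · simp [hg (j - i) (by omega)]

/-- In Faà di Bruno's formula a partition of `j` elements has at most `j < p` blocks, so each term
contains a vanishing derivative of `g`. -/
theorem FlatAt.comp {p : ℕ} {g : F → G} {f : E → F} {x : E} (hgx : ContDiffAt ℝ ∞ g (f x))
    (hfx : ContDiffAt ℝ ∞ f x) (hg : FlatAt p g (f x)) : FlatAt p (g ∘ f) x := by
  intro j hj
  rw [iteratedFDeriv_comp hgx hfx (i := j) (by exact_mod_cast le_top)]
  refine Finset.sum_eq_zero fun c _ => ?_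
  ext v
  rw [FormalMultilinearSeries.compAlongOrderedFinpartition_apply]
  have : ftaylorSeries ℝ g (f x) c.length = 0 := hg _ (c.length_le.trans_lt hj)
  rw [this]
  simp

theorem iteratedFDeriv_comp_affine {k : ℕ} {g : F → G} (L : E →L[ℝ] F) (c : F) {x : E}
    (hg : ContDiffAt ℝ k g (L x + c)) (v : Fin k → E) :
    iteratedFDeriv ℝ k (fun y => g (L y + c)) x v
      = iteratedFDeriv ℝ k g (L x + c) fun i => L (v i) := by
  have hg' : ContDiffAt ℝ k (fun z => g (z + c)) (L x) :=
    ContDiffAt.comp (L x) hg (contDiffAt_id.add contDiffAt_const)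
  obtain ⟨U, hU, hxU, hgU⟩ := exists_isOpen_contDiffOn hg'
  have hLU : IsOpen (L ⁻¹' U) := hU.preimage L.continuous
  have h := L.iteratedFDerivWithin_comp_right hgU hU.uniqueDiffOn hLU.uniqueDiffOn hxU (i := k)
    le_rfl
  rw [iteratedFDerivWithin_of_isOpen _ hLU hxU, iteratedFDerivWithin_of_isOpen _ hU hxU,
    iteratedFDeriv_comp_add_right] at h
  exact congrArg (fun T => T v) h

theorem OrderedFinpartition.partSize_eq_one {n : ℕ} (c : OrderedFinpartition n)
    (h : c.length = n) (m : Fin c.length) : c.partSize m = 1 := by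
  have h1 : ∑ i, c.partSize i = ∑ _i : Fin c.length, 1 := by
    have := c.sum_sigma_eq_sum (fun _ => (1 : ℕ))
    simp at this
    simp [this, h]
  exact ((Finset.sum_eq_sum_iff_of_le fun i _ => c.partSize_pos i).1 h1.symm m
    (Finset.mem_univ m)).symm

/-- Only the partition into singletons survives in Faà di Bruno's formula, and it sees `f` through
its first derivative alone. So `f` may be replaced by its affine approximation `l`. This is why the
principal part of an operator transforms by the linear part of a coordinate change. -/
theorem iteratedFDeriv_comp_of_flatAt {p : ℕ} {g : F → G} {f : E → F} {x : E}
    (hgx : ContDiffAt ℝ ∞ g (f x)) (hfx : ContDiffAt ℝ ∞ f x) (hg : FlatAt p g (f x))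
    (v : Fin p → E) :
    iteratedFDeriv ℝ p (g ∘ f) x v = iteratedFDeriv ℝ p g (f x) fun i => fderiv ℝ f x (v i) := by
  set L := fderiv ℝ f x with hL
  set l : E → F := fun y => L y + (f x - L x) with hl
  have hlx : l x = f x := by simp [hl]
  have hlc : ContDiff ℝ ∞ l := L.contDiff.add contDiff_const
  have hgl : ContDiffAt ℝ ∞ g (l x) := by rwa [hlx]
  have hlL : HasFDerivAt l L x := L.hasFDerivAt.add_const _
  have h1 : iteratedFDeriv ℝ 1 f x = iteratedFDeriv ℝ 1 l x := by
    ext w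
    rw [iteratedFDeriv_one_apply, iteratedFDeriv_one_apply, hlL.fderiv]
  have h2 : iteratedFDeriv ℝ p (g ∘ f) x = iteratedFDeriv ℝ p (g ∘ l) x := by
    rw [iteratedFDeriv_comp hgx hfx (i := p) (by exact_mod_cast le_top),
      iteratedFDeriv_comp hgl hlc.contDiffAt (i := p) (by exact_mod_cast le_top), hlx]
    refine Finset.sum_congr rfl fun c _ => ?_
    ext w
    rw [FormalMultilinearSeries.compAlongOrderedFinpartition_apply,
      FormalMultilinearSeries.compAlongOrderedFinpartition_apply]
    rcases c.length_le.lt_or_eq with hlt | heq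
    · have : ftaylorSeries ℝ g (f x) c.length = 0 := hg _ hlt
      simp [this]
    · congr 1
      funext m
      have h3 : ∀ k, k = 1 → iteratedFDeriv ℝ k f x = iteratedFDeriv ℝ k l x := by
        rintro _ rfl
        exact h1
      exact congrArg (fun T => T (w ∘ c.emb m)) (h3 _ (c.partSize_eq_one heq m))
  rw [h2]
  have := iteratedFDeriv_comp_affine (k := p) (g := g) L (f x - L x) (x := x)
    (hgl.of_le (by exact_mod_cast le_top)) v
  rw [show L x + (f x - L x) = f x from hlx] at this
  exact this

end Analysis

/-! ### Homogeneous Taylor terms and rescaling limits -/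

section Taylor

variable {E F : Type*} [NormedAddCommGroup E] [NormedSpace ℝ E] [NormedAddCommGroup F]
  [NormedSpace ℝ F]

theorem contDiff_diagonal {k : ℕ} (T : E [×k]→L[ℝ] F) {N : ℕ∞ω} :
    ContDiff ℝ N fun y => T fun _ => y :=
  T.contDiff.comp (contDiff_pi.2 fun _ => contDiff_id)

/-- The derivatives of a homogeneous polynomial are homogeneous. -/
theorem iteratedFDeriv_diagonal_smul {k : ℕ} (T : E [×k]→L[ℝ] F) (j : ℕ) (s : ℝ) (x : E) :
    s ^ j • iteratedFDeriv ℝ j (fun y => T fun _ => y) (s • x)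
      = s ^ k • iteratedFDeriv ℝ j (fun y => T fun _ => y) x := by
  have h := congrFun (iteratedFDeriv_comp_const_smul (i := j) s
    (contDiff_diagonal T (N := (j : ℕ)))) x
  rw [← h, ← iteratedFDeriv_const_smul_apply (contDiff_diagonal T).contDiffAt]
  congr 1
  funext y
  simp [T.map_smul_univ (fun _ => s) fun _ => y]

/-- The `k`-th derivative is a sum over permutations in which the base point no longer occurs, hence
constant. -/
theorem iteratedFDeriv_diagonal_eq_zero_of_lt {k j : ℕ} (T : E [×k]→L[ℝ] F) (h : k < j) (x : E) :
    iteratedFDeriv ℝ j (fun y => T fun _ => y) x = 0 := by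
  suffices H : ∀ i, k < i → iteratedFDeriv ℝ i (fun y => T fun _ => y) = 0 by rw [H j h]; rfl
  intro i hi
  induction i, hi using Nat.le_induction with
  | base =>
    have hc : iteratedFDeriv ℝ k (fun y => T fun _ => y)
        = fun _ => iteratedFDeriv ℝ k (fun y => T fun _ => y) 0 := by
      funext y
      ext v
      rw [T.iteratedFDeriv_comp_diagonal, T.iteratedFDeriv_comp_diagonal]
    funext y
    ext v
    rw [iteratedFDeriv_succ_apply_left, hc]
    simp
  | succ i hi ih =>
    funext y
    ext v
    rw [iteratedFDeriv_succ_apply_left, ih]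
    simp

/-- The origin is fixed by scaling, so homogeneity with factor `2` equates `2 ^ j` and `2 ^ k` times
the derivative. -/
theorem iteratedFDeriv_diagonal_zero {k j : ℕ} (T : E [×k]→L[ℝ] F) (h : j ≠ k) :
    iteratedFDeriv ℝ j (fun y => T fun _ => y) 0 = 0 := by
  have h1 := iteratedFDeriv_diagonal_smul T j 2 0
  rw [smul_zero, ← sub_eq_zero, ← sub_smul, smul_eq_zero, sub_eq_zero] at h1
  refine h1.resolve_left fun h2 => h ?_
  exact Nat.pow_right_injective le_rfl (by exact_mod_cast h2)

/-- The homogeneous component of degree `p` of the Taylor expansion of `f` at `x`. -/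
def taylorTerm (p : ℕ) (f : E → F) (x y : E) : F :=
  ((p.factorial : ℝ)⁻¹ • iteratedFDeriv ℝ p f x) fun _ => y

theorem contDiff_taylorTerm (p : ℕ) (f : E → F) (x : E) {N : ℕ∞ω} :
    ContDiff ℝ N (taylorTerm p f x) :=
  contDiff_diagonal _

theorem iteratedFDeriv_diagonal_eq {p : ℕ} {T : E [×p]→L[ℝ] F}
    (hT : ∀ (σ : Equiv.Perm (Fin p)) v, T (v ∘ σ) = T v) :
    iteratedFDeriv ℝ p (fun y => ((p.factorial : ℝ)⁻¹ • T) fun _ => y) 0 = T := by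
  ext v
  rw [ContinuousMultilinearMap.iteratedFDeriv_comp_diagonal]
  have : ∀ σ : Equiv.Perm (Fin p), ((p.factorial : ℝ)⁻¹ • T) (fun i => v (σ i))
      = (p.factorial : ℝ)⁻¹ • T v := fun σ => by rw [← hT σ v]; rfl
  rw [Finset.sum_congr rfl fun σ _ => this σ, Finset.sum_const, Finset.card_univ, Fintype.card_perm,
    Fintype.card_fin, ← Nat.cast_smul_eq_nsmul ℝ, smul_smul, mul_inv_cancel₀ (by positivity),
    one_smul]

theorem iteratedFDeriv_taylorTerm {p : ℕ} {f : E → F} {x : E} (hf : ContDiffAt ℝ p f x) :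
    iteratedFDeriv ℝ p (taylorTerm p f x) 0 = iteratedFDeriv ℝ p f x :=
  iteratedFDeriv_diagonal_eq fun σ v => iteratedFDeriv_comp_perm hf σ v

theorem flatAt_sub_taylorTerm {p : ℕ} {f : E → F} {x : E} (hf : ContDiffAt ℝ ∞ f x)
    (h : FlatAt p f x) : FlatAt (p + 1) (fun y => f y - taylorTerm p f x (y - x)) x := by
  intro j hj
  have hfj : ContDiffAt ℝ j f x := hf.of_le (by exact_mod_cast le_top)
  have hs : ContDiff ℝ j fun y => taylorTerm p f x (y - x) :=
    (contDiff_taylorTerm p f x).comp (contDiff_id.sub contDiff_const)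
  rw [fun_iteratedFDeriv_sub_apply hfj hs.contDiffAt, iteratedFDeriv_comp_sub, sub_self]
  rcases (Nat.lt_succ_iff.1 hj).lt_or_eq with hlt | rfl
  · rw [h j hlt, zero_sub, neg_eq_zero]
    exact iteratedFDeriv_diagonal_zero _ hlt.ne
  · rw [iteratedFDeriv_taylorTerm hfj, sub_self]

theorem flatAt_sub_sum_taylorTerm {f : E → F} {x : E} (hf : ContDiffAt ℝ ∞ f x) (N : ℕ) :
    FlatAt N (fun y => f y - ∑ k ∈ Finset.range N, taylorTerm k f x (y - x)) x := by
  have hs : ∀ k, ContDiff ℝ ∞ fun y => taylorTerm k f x (y - x) := fun k =>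
    (contDiff_taylorTerm k f x).comp (contDiff_id.sub contDiff_const)
  induction N with
  | zero => exact fun j hj => absurd hj (by omega)
  | succ N ih =>
    have hr : ContDiffAt ℝ ∞ (fun y => f y - ∑ k ∈ Finset.range N, taylorTerm k f x (y - x)) x :=
      hf.sub (ContDiff.sum fun k _ => hs k).contDiffAt
    have h := flatAt_sub_taylorTerm hr ih
    have hN : iteratedFDeriv ℝ N
        (fun y => f y - ∑ k ∈ Finset.range N, taylorTerm k f x (y - x)) x
        = iteratedFDeriv ℝ N f x := by
      have hd : ContDiff ℝ N fun y => ∑ k ∈ Finset.range N, taylorTerm k f x (y - x) :=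
        ContDiff.sum fun k _ => (hs k).of_le (by exact_mod_cast le_top)
      rw [fun_iteratedFDeriv_sub_apply (hf.of_le (by exact_mod_cast le_top)) hd.contDiffAt,
        iteratedFDeriv_fun_sum_apply fun k _ =>
          ((hs k).of_le (by exact_mod_cast le_top)).contDiffAt]
      rw [Finset.sum_eq_zero, sub_zero]
      intro k hk
      rw [iteratedFDeriv_comp_sub, sub_self]
      exact iteratedFDeriv_diagonal_zero _ (Finset.mem_range.1 hk).ne'
    have hN' : taylorTerm N (fun y => f y - ∑ k ∈ Finset.range N, taylorTerm k f x (y - x)) x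
        = taylorTerm N f x := by
      funext z
      rw [taylorTerm, hN, taylorTerm]
    rw [hN'] at h
    refine h.congr (Filter.Eventually.of_forall fun y => ?_)
    simp only [Finset.sum_range_succ, sub_add_eq_sub_sub]

/-- Descending induction on `k`. It starts from continuity of the `p`-th derivative, which is zero
at `x`; the mean value inequality on the ball of radius `‖y - x‖` then gains one factor `‖y - x‖` at
each step. -/
theorem FlatAt.isLittleO {p : ℕ} {f : E → F} {x : E} (hf : ContDiffAt ℝ p f x)
    (h : FlatAt (p + 1) f x) {k : ℕ} (hk : k ≤ p) :
    (fun y => iteratedFDeriv ℝ k f y) =o[𝓝 x] fun y => ‖y - x‖ ^ (p - k) := by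
  induction hk using Nat.decreasingInduction with
  | self =>
    simp only [le_refl, tsub_eq_zero_of_le, pow_zero]
    rw [Asymptotics.isLittleO_one_iff]
    have := (hf.iteratedFDeriv_right (m := 0) (i := p) (by simp)).continuousAt
    rwa [ContinuousAt, h p (by omega)] at this
  | of_succ k hk ih =>
    have hkp : k < p := hk
    rw [Asymptotics.isLittleO_iff] at ih ⊢
    intro c hc
    have hd : ∀ᶠ y in 𝓝 x, ContDiffAt ℝ p f y := hf.eventually (by simp)
    obtain ⟨ε, hε, hball⟩ := Metric.eventually_nhds_iff_ball.1 ((ih hc).and hd)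
    filter_upwards [Metric.ball_mem_nhds x hε] with y hy
    have hdiff : ∀ z ∈ Metric.closedBall x ‖y - x‖,
        DifferentiableAt ℝ (iteratedFDeriv ℝ k f) z := fun z hz => by
      have hz' : z ∈ Metric.ball x ε := by
        rw [Metric.mem_ball, dist_eq_norm] at *
        rw [Metric.mem_closedBall, dist_eq_norm] at hz
        exact hz.trans_lt hy
      exact ((hball z hz').2.iteratedFDeriv_right (m := 1)
        (by norm_cast; omega)).differentiableAt (by simp)
    have hbound : ∀ z ∈ Metric.closedBall x ‖y - x‖,
        ‖fderiv ℝ (iteratedFDeriv ℝ k f) z‖ ≤ c * ‖y - x‖ ^ (p - (k + 1)) := fun z hz => by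
      rw [Metric.mem_closedBall, dist_eq_norm] at hz
      have hz' : z ∈ Metric.ball x ε := by
        rw [Metric.mem_ball, dist_eq_norm] at *
        exact hz.trans_lt hy
      rw [norm_fderiv_iteratedFDeriv]
      refine (hball z hz').1.trans ?_
      rw [norm_pow, norm_norm]
      gcongr
    have := (convex_closedBall x ‖y - x‖).norm_image_sub_le_of_norm_fderiv_le hdiff hbound
      (Metric.mem_closedBall_self (norm_nonneg _))
      (Metric.mem_closedBall.2 (dist_eq_norm y x).le)
    rw [h k (by omega), sub_zero, mul_assoc, ← pow_succ] at this
    rw [norm_pow, norm_norm]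
    convert this using 3
    omega

/-- If `f` vanishes to order `p` at `x`, then the rescaled derivatives of `f` along `x + s X`
converge to those of its leading Taylor term. -/
theorem FlatAt.tendsto_iteratedFDeriv {p : ℕ} {f : E → F} {x : E} (hf : ContDiffAt ℝ ∞ f x)
    (h : FlatAt p f x) {k : ℕ} (hk : k ≤ p) (X : E) :
    Filter.Tendsto (fun s : ℝ => (s ^ (p - k))⁻¹ • iteratedFDeriv ℝ k f (x + s • X)) (𝓝[≠] 0)
      (𝓝 (iteratedFDeriv ℝ k (taylorTerm p f x) X)) := by
  have hpath : Filter.Tendsto (fun s : ℝ => x + s • X) (𝓝[≠] 0) (𝓝 x) := by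
    have : Continuous fun s : ℝ => x + s • X := by fun_prop
    have := this.tendsto 0
    simp only [zero_smul, add_zero] at this
    exact this.mono_left nhdsWithin_le_nhds
  have hs : ContDiff ℝ ∞ fun y => taylorTerm p f x (y - x) :=
    (contDiff_taylorTerm p f x).comp (contDiff_id.sub contDiff_const)
  set r := fun y => f y - taylorTerm p f x (y - x) with hr
  have hrc : ContDiffAt ℝ ∞ r x := hf.sub hs.contDiffAt
  have hfk : ∀ᶠ y in 𝓝 x, ContDiffAt ℝ k f y :=
    (hf.of_le (by exact_mod_cast le_top)).eventually (by simp)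
  -- Removing the leading term raises the order of vanishing, so the remainder is `o(s ^ (p - k))`
  -- along the path.
  have ho := ((flatAt_sub_taylorTerm hf h).isLittleO
    (hrc.of_le (by exact_mod_cast le_top)) hk).comp_tendsto hpath
  have h0 : Filter.Tendsto (fun s : ℝ => (s ^ (p - k))⁻¹ • iteratedFDeriv ℝ k r (x + s • X))
      (𝓝[≠] 0) (𝓝 0) := by
    have hO : (fun s : ℝ => ‖(x + s • X) - x‖ ^ (p - k)) =O[𝓝[≠] 0] fun s : ℝ => s ^ (p - k) := by
      refine Asymptotics.IsBigO.of_bound (‖X‖ ^ (p - k)) (Filter.Eventually.of_forall fun s => ?_)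
      simp [norm_smul, mul_pow, mul_comm]
    have ho' := ho.trans_isBigO hO
    rw [Asymptotics.isLittleO_iff] at ho'
    rw [Metric.tendsto_nhds]
    intro ε hε
    filter_upwards [ho' (half_pos hε), self_mem_nhdsWithin] with s hs hs0
    have hs0' : s ≠ 0 := hs0
    rw [dist_zero_right, norm_smul, norm_inv]
    have hpos : 0 < ‖s ^ (p - k)‖ := norm_pos_iff.2 (pow_ne_zero _ hs0')
    rw [inv_mul_lt_iff₀ hpos]
    refine lt_of_le_of_lt hs ?_
    rw [mul_comm]
    gcongr
    linarith
  have h1 := h0.add_const (iteratedFDeriv ℝ k (taylorTerm p f x) X)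
  rw [zero_add] at h1
  refine h1.congr' ?_
  filter_upwards [self_mem_nhdsWithin, hpath.eventually hfk] with s hs0 hsk
  have hs0' : s ≠ 0 := hs0
  rw [hr, fun_iteratedFDeriv_sub_apply hsk (hs.of_le (by exact_mod_cast le_top)).contDiffAt,
    iteratedFDeriv_comp_sub, add_sub_cancel_left, smul_sub]
  have hom := iteratedFDeriv_diagonal_smul ((p.factorial : ℝ)⁻¹ • iteratedFDeriv ℝ p f x) k s X
  have hom' : iteratedFDeriv ℝ k (taylorTerm p f x) (s • X)
      = s ^ (p - k) • iteratedFDeriv ℝ k (taylorTerm p f x) X := by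
    have hsk' : s ^ k ≠ 0 := pow_ne_zero _ hs0'
    refine (smul_right_injective _ hsk') ?_
    change s ^ k • _ = s ^ k • _
    rw [smul_smul, ← pow_add, Nat.add_sub_cancel' hk]
    exact hom
  rw [hom', smul_smul, inv_mul_cancel₀ (pow_ne_zero _ hs0'), one_smul]
  abel

end Taylor

/-! ### Locality of differential operators and the chain rule -/

section PointwiseDiffOp

theorem eventuallyEq_comp_symm {n : ℕ} {M : Type*} [TopologicalSpace M]
    {φ : OpenPartialHomeomorph M (EuclideanSpace ℝ (Fin n))} {m : M} (hm : m ∈ φ.source)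
    {N : Type*} {f g : M → N} (h : f =ᶠ[𝓝 m] g) :
    f ∘ φ.symm =ᶠ[𝓝 (φ m)] g ∘ φ.symm := by
  have h1 : Filter.Tendsto φ.symm (𝓝 (φ m)) (𝓝 m) := by
    have := (φ.continuousAt_symm (φ.map_source hm)).tendsto
    rwa [φ.left_inv hm] at this
  exact h1.eventually h

variable {n : ℕ} {M : Type*} [TopologicalSpace M] [ChartedSpace (EuclideanSpace ℝ (Fin n)) M]

theorem contDiffAt_comp_symm [IsManifold (𝓡 n) ∞ M]
    {φ : OpenPartialHomeomorph M (EuclideanSpace ℝ (Fin n))}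
    (hφ : φ ∈ IsManifold.maximalAtlas (𝓡 n) ∞ M) {N : Type*} [NormedAddCommGroup N]
    [NormedSpace ℝ N] {f : M → N} (hf : ContMDiff (𝓡 n) 𝓘(ℝ, N) ∞ f) {y : EuclideanSpace ℝ (Fin n)}
    (hy : y ∈ φ.target) : ContDiffAt ℝ ∞ (f ∘ φ.symm) y := by
  have h1 : ContMDiffOn (𝓡 n) 𝓘(ℝ, N) ∞ (f ∘ φ.symm) φ.target :=
    hf.comp_contMDiffOn (contMDiffOn_symm_of_mem_maximalAtlas hφ)
  exact (contMDiffOn_iff_contDiffOn.1 h1).contDiffAt (φ.open_target.mem_nhds hy)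

/-- Near `m` the smooth function `f` vanishes to order `p` at `m`, in the preferred coordinates. -/
theorem flatAt_of_mem_pow [IsManifold (𝓡 n) ∞ M] {m : M} {p : ℕ} {f : C^∞⟮𝓡 n, M; ℝ⟯}
    (hf : f ∈ smoothVanishingIdeal (𝓡 n) {m} ^ p) :
    FlatAt p (f ∘ (chartAt (EuclideanSpace ℝ (Fin n)) m).symm)
      (chartAt (EuclideanSpace ℝ (Fin n)) m m) := by
  set φ := chartAt (EuclideanSpace ℝ (Fin n)) m with hφ
  have hmt : φ m ∈ φ.target := φ.map_source (mem_chart_source _ m)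
  have hs : ∀ g : C^∞⟮𝓡 n, M; ℝ⟯, ContDiffAt ℝ ∞ (g ∘ φ.symm) (φ m) := fun g =>
    contDiffAt_comp_symm (IsManifold.chart_mem_maximalAtlas m) g.contMDiff hmt
  induction p generalizing f with
  | zero => exact fun j hj => absurd hj (by omega)
  | succ p ih =>
    rw [pow_succ] at hf
    refine Submodule.mul_induction_on hf (fun g hg h hh => ?_) fun g h hg hh =>
      FlatAt.add (hs g) (hs h) hg hh
    refine FlatAt.mul (hs g) (hs h) (ih hg) fun j hj => ?_
    obtain rfl : j = 0 := by omega
    ext v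
    rw [iteratedFDeriv_zero_apply]
    change h (φ.symm (φ m)) = 0
    rw [φ.left_inv (mem_chart_source _ m)]
    exact hh m rfl

variable {q : ℕ} {D : C^∞⟮𝓡 n, M; ℝ⟯ →ₗ[ℝ] C^∞⟮𝓡 n, M; ℝ⟯}

theorem HasLocalExpression.apply_congr
    {φ : OpenPartialHomeomorph M (EuclideanSpace ℝ (Fin n))}
    {a : (k : ℕ) → (Fin k → Fin n) → EuclideanSpace ℝ (Fin n) → ℝ}
    (h : HasLocalExpression q D φ a) {m : M} (hm : m ∈ φ.source) {f g : C^∞⟮𝓡 n, M; ℝ⟯}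
    (hfg : (f : M → ℝ) =ᶠ[𝓝 m] g) : D f m = D g m := by
  rw [h.2 f m hm, h.2 g m hm]
  refine Finset.sum_congr rfl fun k _ => Finset.sum_congr rfl fun w _ => ?_
  rw [((eventuallyEq_comp_symm hm hfg).iteratedFDeriv ℝ k).eq_of_nhds]

/-- Differential operators are local. -/
theorem IsDiffOp.apply_congr (hD : IsDiffOp q D) {m : M} {f g : C^∞⟮𝓡 n, M; ℝ⟯}
    (hfg : (f : M → ℝ) =ᶠ[𝓝 m] g) : D f m = D g m := by
  obtain ⟨a, ha⟩ := hD m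
  exact ha.apply_congr (mem_chart_source _ m) hfg

theorem HasLocalExpression.apply_eq_of_flatAt
    {φ : OpenPartialHomeomorph M (EuclideanSpace ℝ (Fin n))}
    {a : (k : ℕ) → (Fin k → Fin n) → EuclideanSpace ℝ (Fin n) → ℝ}
    (h : HasLocalExpression q D φ a) {m : M} (hm : m ∈ φ.source) {f : C^∞⟮𝓡 n, M; ℝ⟯}
    (hf : FlatAt q (f ∘ φ.symm) (φ m)) :
    D f m = ∑ w : Fin q → Fin n,
      a q w (φ m) * iteratedFDeriv ℝ q (f ∘ φ.symm) (φ m) fun j =>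
        EuclideanSpace.single (w j) 1 := by
  rw [h.2 f m hm, Finset.sum_range_succ, add_eq_right]
  refine Finset.sum_eq_zero fun k hk => Finset.sum_eq_zero fun w _ => ?_
  rw [hf k (Finset.mem_range.1 hk)]
  simp

theorem IsDiffOp.apply_eq_zero_of_flatAt (hD : IsDiffOp q D) {m : M} {f : C^∞⟮𝓡 n, M; ℝ⟯}
    (hf : FlatAt (q + 1) (f ∘ (chartAt (EuclideanSpace ℝ (Fin n)) m).symm)
      (chartAt (EuclideanSpace ℝ (Fin n)) m m)) : D f m = 0 := by
  obtain ⟨a, ha⟩ := hD m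
  rw [ha.apply_eq_of_flatAt (mem_chart_source _ m) (hf.mono (by omega)), hf q (by omega)]
  simp

theorem IsDiffOp.apply_eq_zero_of_mem_pow [IsManifold (𝓡 n) ∞ M] (hD : IsDiffOp q D) {m : M}
    {f : C^∞⟮𝓡 n, M; ℝ⟯} (hf : f ∈ smoothVanishingIdeal (𝓡 n) {m} ^ (q + 1)) : D f m = 0 :=
  hD.apply_eq_zero_of_flatAt (flatAt_of_mem_pow hf)

/-- The Taylor term in terms of coordinates. -/
theorem taylorTerm_pi {k j : ℕ} (h : (Fin k → ℝ) → ℝ) (u₀ u : Fin k → ℝ) :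
    taylorTerm j h u₀ u = ∑ w : Fin j → Fin k,
      ((j.factorial : ℝ)⁻¹ * iteratedFDeriv ℝ j h u₀ fun i => Pi.single (w i) 1) *
        ∏ i, u (w i) := by
  have hu : u = ∑ i : Fin k, u i • (Pi.single i 1 : Fin k → ℝ) := by
    ext i
    simp [Finset.sum_apply, Pi.single_apply]
  rw [taylorTerm]
  conv_lhs => rw [hu]
  rw [ContinuousMultilinearMap.map_sum]
  refine Finset.sum_congr rfl fun w _ => ?_
  rw [ContinuousMultilinearMap.map_smul_univ]
  simp only [smul_apply, smul_eq_mul]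
  ring

theorem ContMDiffMap.sum_apply {ι : Type*} (s : Finset ι) (f : ι → C^∞⟮𝓡 n, M; ℝ⟯) (m : M) :
    (∑ i ∈ s, f i) m = ∑ i ∈ s, f i m :=
  map_sum (ContMDiffMap.evalRingHom (I := 𝓡 n) (I' := 𝓘(ℝ, ℝ)) (n := ∞) m) f s

theorem ContMDiffMap.prod_apply {ι : Type*} (s : Finset ι) (f : ι → C^∞⟮𝓡 n, M; ℝ⟯) (m : M) :
    (∏ i ∈ s, f i) m = ∏ i ∈ s, f i m :=
  map_prod (ContMDiffMap.evalRingHom (I := 𝓡 n) (I' := 𝓘(ℝ, ℝ)) (n := ∞) m) f s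

/-- The chain rule for a differential operator, by Taylor expansion of the outer function. -/
theorem IsDiffOp.apply_comp [IsManifold (𝓡 n) ∞ M] (hD : IsDiffOp q D) {k : ℕ}
    (a : Fin k → C^∞⟮𝓡 n, M; ℝ⟯) {h : (Fin k → ℝ) → ℝ} (hh : ContDiff ℝ ∞ h)
    {f : C^∞⟮𝓡 n, M; ℝ⟯} {m : M} (hf : ∀ᶠ m' in 𝓝 m, f m' = h fun j => a j m') :
    D f m = ∑ j ∈ Finset.range (q + 1), ∑ w : Fin j → Fin k, ∑ S : Finset (Fin j),
      ((j.factorial : ℝ)⁻¹ * iteratedFDeriv ℝ j h (fun j => a j m) fun i => Pi.single (w i) 1) *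
        ((∏ i ∈ Sᶜ, -a (w i) m) * D (∏ i ∈ S, a (w i)) m) := by
  set u₀ : Fin k → ℝ := fun j => a j m with hu₀
  set c : (j : ℕ) → (Fin j → Fin k) → ℝ := fun j w =>
    (j.factorial : ℝ)⁻¹ * iteratedFDeriv ℝ j h u₀ fun i => Pi.single (w i) 1 with hc
  -- The Taylor polynomial of `h` of degree `q` at `u₀`, evaluated on the `a j` inside the algebra
  -- of smooth functions, where `D` can be applied to it.
  set g : C^∞⟮𝓡 n, M; ℝ⟯ := ∑ j ∈ Finset.range (q + 1), ∑ w : Fin j → Fin k,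
    c j w • ∏ i, (a (w i) + algebraMap ℝ _ (-(u₀ (w i)))) with hg
  have hgapp : ∀ m', g m' = ∑ j ∈ Finset.range (q + 1),
      taylorTerm j h u₀ ((fun j => a j m') - u₀) := by
    intro m'
    rw [hg, ContMDiffMap.sum_apply]
    refine Finset.sum_congr rfl fun j _ => ?_
    rw [ContMDiffMap.sum_apply, taylorTerm_pi]
    refine Finset.sum_congr rfl fun w _ => ?_
    rw [ContMDiffMap.coe_smul, Pi.smul_apply, ContMDiffMap.prod_apply, smul_eq_mul]
    congr 1
  have hDg : D g m = ∑ j ∈ Finset.range (q + 1), ∑ w : Fin j → Fin k, ∑ S : Finset (Fin j),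
      c j w * ((∏ i ∈ Sᶜ, -a (w i) m) * D (∏ i ∈ S, a (w i)) m) := by
    rw [hg, map_sum, ContMDiffMap.sum_apply]
    refine Finset.sum_congr rfl fun j _ => ?_
    rw [map_sum, ContMDiffMap.sum_apply]
    refine Finset.sum_congr rfl fun w _ => ?_
    -- The product of the differences `a - a(m)` is expanded over subsets `S`; the constants indexed
    -- by `Sᶜ` come out of `D` by linearity.
    rw [map_smul, Finset.prod_add, map_sum, ContMDiffMap.coe_smul, Pi.smul_apply,
      ContMDiffMap.sum_apply, smul_eq_mul, Finset.mul_sum, Finset.powerset_univ]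
    refine Finset.sum_congr rfl fun S _ => ?_
    rw [← map_prod, mul_comm (∏ i ∈ S, a (w i)), ← Algebra.smul_def, map_smul,
      ContMDiffMap.coe_smul, Pi.smul_apply, smul_eq_mul, ← Finset.compl_eq_univ_sdiff]
  rw [← hDg, ← sub_eq_zero]
  have : D f m - D g m = D (f - g) m := by rw [map_sub]; rfl
  rw [this]
  -- Near `m`, `f - g` is the Taylor remainder of `h` composed with a smooth map, hence flat to
  -- order `q + 1`.
  apply hD.apply_eq_zero_of_flatAt
  set φ := chartAt (EuclideanSpace ℝ (Fin n)) m with hφ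
  have hms := mem_chart_source (EuclideanSpace ℝ (Fin n)) m
  have hmt : φ m ∈ φ.target := φ.map_source hms
  have ha : ContMDiff (𝓡 n) 𝓘(ℝ, Fin k → ℝ) ∞ fun m' => fun j => a j m' :=
    contMDiff_pi_space.2 fun j => (a j).contMDiff
  have hac : ContDiffAt ℝ ∞ ((fun m' => fun j => a j m') ∘ φ.symm) (φ m) :=
    contDiffAt_comp_symm (IsManifold.chart_mem_maximalAtlas m) ha hmt
  have hau : ((fun m' => fun j => a j m') ∘ φ.symm) (φ m) = u₀ := by
    rw [Function.comp_apply, φ.left_inv hms]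
  have hr : ContDiff ℝ ∞ fun u => h u - ∑ j ∈ Finset.range (q + 1), taylorTerm j h u₀ (u - u₀) :=
    hh.sub (ContDiff.sum fun j _ =>
      (contDiff_taylorTerm j h u₀).comp (contDiff_id.sub contDiff_const))
  have hflat := flatAt_sub_sum_taylorTerm hh.contDiffAt (x := u₀) (q + 1)
  rw [← hau] at hflat
  rw [← hau] at hr
  refine (FlatAt.comp hr.contDiffAt hac hflat).congr (eventuallyEq_comp_symm
    (g := fun m' => (fun u => h u - ∑ j ∈ Finset.range (q + 1), taylorTerm j h
      (((fun m' j => (a j) m') ∘ φ.symm) (φ m)) (u - ((fun m' j => (a j) m') ∘ φ.symm) (φ m)))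
        (fun j => a j m')) hms ?_)
  filter_upwards [hf] with m' hm'
  rw [hau]
  change f m' - g m' = _
  rw [hm', hgapp]

end PointwiseDiffOp

/-! ### The model operator: invariance and rescaling limit -/

section ModelOperator

variable {n : ℕ} {M : Type u} [TopologicalSpace M] [ChartedSpace (EuclideanSpace ℝ (Fin n)) M]

/-- Elements of `T_m M` are written in the preferred chart at `m`, so a coordinate vector is a
column of the Jacobian of the transition map. -/
theorem coordVector_eq_fderiv [IsManifold (𝓡 n) ∞ M]
    {φ : OpenPartialHomeomorph M (EuclideanSpace ℝ (Fin n))}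
    (hφ : φ ∈ IsManifold.maximalAtlas (𝓡 n) ∞ M) {m : M} (hm : m ∈ φ.source) (i : Fin n) :
    coordVector φ m i = fderiv ℝ (chartAt (EuclideanSpace ℝ (Fin n)) m ∘ φ.symm) (φ m)
      (EuclideanSpace.single i 1) := by
  have hd : MDifferentiableAt (𝓡 n) (𝓡 n) φ.symm (φ m) :=
    ((contMDiffOn_symm_of_mem_maximalAtlas hφ).contMDiffAt
      (φ.open_target.mem_nhds (φ.map_source hm))).mdifferentiableAt (by simp)
  have h1 : coordVector φ m i = fderivWithin ℝ (writtenInExtChartAt (𝓡 n) (𝓡 n) (φ m) φ.symm)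
      (Set.range (𝓡 n)) (extChartAt (𝓡 n) (φ m) (φ m)) (EuclideanSpace.single i 1) :=
    congrArg (fun T : EuclideanSpace ℝ (Fin n) →L[ℝ] EuclideanSpace ℝ (Fin n) =>
      T (EuclideanSpace.single i 1)) hd.mfderiv
  rw [h1]
  simp only [writtenInExtChartAt, mfld_simps, fderivWithin_univ, φ.left_inv hm, chartAt_self_eq]

theorem coordVector_chartAt [IsManifold (𝓡 n) ∞ M] (m : M) (i : Fin n) :
    coordVector (chartAt (EuclideanSpace ℝ (Fin n)) m) m i = EuclideanSpace.single i 1 := by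
  set φ := chartAt (EuclideanSpace ℝ (Fin n)) m with hφ
  rw [coordVector_eq_fderiv (IsManifold.chart_mem_maximalAtlas m) (mem_chart_source _ m)]
  have h : φ ∘ φ.symm =ᶠ[𝓝 (φ m)] id := by
    filter_upwards [φ.open_target.mem_nhds (φ.map_source (mem_chart_source _ m))] with y hy
    exact φ.right_inv hy
  rw [h.fderiv_eq, fderiv_id]
  rfl

variable {q : ℕ} {D : C^∞⟮𝓡 n, M; ℝ⟯ →ₗ[ℝ] C^∞⟮𝓡 n, M; ℝ⟯}

theorem modelOperator_apply [IsManifold (𝓡 n) ∞ M] (hD : IsDiffOp q D) (m : M)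
    (g : C^∞⟮𝓡 n, EuclideanSpace ℝ (Fin n); ℝ⟯) (v : EuclideanSpace ℝ (Fin n)) :
    modelOperator hD m g v = ∑ w : Fin q → Fin n,
      (hD m).choose q w (chartAt (EuclideanSpace ℝ (Fin n)) m m) *
        iteratedFDeriv ℝ q g v fun j => EuclideanSpace.single (w j) 1 := by
  change ∑ w : Fin q → Fin n, _ * _ = _
  simp only [coordVector_chartAt]

/-- The value `D f m` involves neither `φ` nor `a`, which is the source of their irrelevance. In the
coordinates `φ`, `f` is `P` after the transition map, with `P` flat to order `q`: the lower terms
drop out and the transition map enters only by its derivative, that is, by the coordinate vectors.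
-/
theorem frozenOperator_apply_eq [IsManifold (𝓡 n) ∞ M]
    {φ : OpenPartialHomeomorph M (EuclideanSpace ℝ (Fin n))}
    (hφ : φ ∈ IsManifold.maximalAtlas (𝓡 n) ∞ M)
    {a : (k : ℕ) → (Fin k → Fin n) → EuclideanSpace ℝ (Fin n) → ℝ}
    (h : HasLocalExpression q D φ a) {m : M} (hm : m ∈ φ.source)
    (g : C^∞⟮𝓡 n, EuclideanSpace ℝ (Fin n); ℝ⟯) (v : EuclideanSpace ℝ (Fin n))
    {f : C^∞⟮𝓡 n, M; ℝ⟯} (hf : ∀ᶠ m' in 𝓝 m, f m' = taylorTerm q g v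
      (chartAt (EuclideanSpace ℝ (Fin n)) m m' - chartAt (EuclideanSpace ℝ (Fin n)) m m)) :
    frozenOperator q φ a m g v = D f m := by
  set χ := chartAt (EuclideanSpace ℝ (Fin n)) m with hχ
  have hms : m ∈ χ.source := mem_chart_source _ m
  set P : EuclideanSpace ℝ (Fin n) → ℝ := fun y => taylorTerm q g v (y - χ m) with hP
  have hτm : (χ ∘ φ.symm) (φ m) = χ m := by rw [Function.comp_apply, φ.left_inv hm]
  have hτ : ContDiffAt ℝ ∞ (χ ∘ φ.symm) (φ m) := by
    have h1 : ContMDiffAt (𝓡 n) (𝓡 n) ∞ χ (φ.symm (φ m)) := by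
      rw [φ.left_inv hm]
      exact contMDiffAt_of_mem_maximalAtlas (IsManifold.chart_mem_maximalAtlas m) hms
    exact (h1.comp (φ m) (contMDiffAt_symm_of_mem_maximalAtlas hφ (φ.map_source hm))).contDiffAt
  have hPc : ContDiff ℝ ∞ P :=
    (contDiff_taylorTerm q g v).comp (contDiff_id.sub contDiff_const)
  have hg : ContDiffAt ℝ q g v := (contMDiff_iff_contDiff.1 g.contMDiff).contDiffAt.of_le
    (by exact_mod_cast le_top)
  have hPflat : FlatAt q P ((χ ∘ φ.symm) (φ m)) := fun j hj => by
    rw [hτm, hP, iteratedFDeriv_comp_sub, sub_self]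
    exact iteratedFDeriv_diagonal_zero _ hj.ne
  have hPq : iteratedFDeriv ℝ q P ((χ ∘ φ.symm) (φ m)) = iteratedFDeriv ℝ q g v := by
    rw [hτm, hP, iteratedFDeriv_comp_sub, sub_self, iteratedFDeriv_taylorTerm hg]
  have hfe : f ∘ φ.symm =ᶠ[𝓝 (φ m)] P ∘ χ ∘ φ.symm :=
    eventuallyEq_comp_symm (g := fun m' => P (χ m')) hm hf
  have hflat := (FlatAt.comp hPc.contDiffAt hτ hPflat).congr hfe
  rw [h.apply_eq_of_flatAt hm hflat]
  change ∑ w : Fin q → Fin n, _ = _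
  refine Finset.sum_congr rfl fun w _ => ?_
  rw [(hfe.iteratedFDeriv ℝ q).eq_of_nhds, iteratedFDeriv_comp_of_flatAt hPc.contDiffAt hτ hPflat,
    hPq]
  simp only [coordVector_eq_fderiv hφ hm, ← hχ]

theorem exists_contMDiffMap_eventuallyEq [IsManifold (𝓡 n) ∞ M] [T2Space M] (m : M)
    {P : EuclideanSpace ℝ (Fin n) → ℝ} (hP : ContDiff ℝ ∞ P) :
    ∃ f : C^∞⟮𝓡 n, M; ℝ⟯,
      ∀ᶠ m' in 𝓝 m, f m' = P (chartAt (EuclideanSpace ℝ (Fin n)) m m') := by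
  obtain ⟨b⟩ : Nonempty (SmoothBumpFunction (𝓡 n) m) := inferInstance
  have h1 : ContMDiffOn (𝓡 n) 𝓘(ℝ, ℝ) ∞
      (fun m' => P (chartAt (EuclideanSpace ℝ (Fin n)) m m'))
      (chartAt (EuclideanSpace ℝ (Fin n)) m).source :=
    hP.contMDiff.comp_contMDiffOn
      (contMDiffOn_of_mem_maximalAtlas (IsManifold.chart_mem_maximalAtlas m))
  refine ⟨⟨fun m' => b m' • P (chartAt (EuclideanSpace ℝ (Fin n)) m m'), b.contMDiff_smul h1⟩, ?_⟩
  filter_upwards [b.eventuallyEq_one] with m' hm'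
  change b m' • P _ = _
  rw [hm']
  simp

/-- The model operator does not depend on the local coordinates, nor on the local expression. -/
theorem modelOperator_eq_frozenOperator [IsManifold (𝓡 n) ∞ M] [T2Space M] (hD : IsDiffOp q D)
    {φ : OpenPartialHomeomorph M (EuclideanSpace ℝ (Fin n))}
    (hφ : φ ∈ IsManifold.maximalAtlas (𝓡 n) ∞ M)
    {a : (k : ℕ) → (Fin k → Fin n) → EuclideanSpace ℝ (Fin n) → ℝ}
    (h : HasLocalExpression q D φ a) {m : M} (hm : m ∈ φ.source) :
    modelOperator hD m = frozenOperator q φ a m := by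
  ext g v
  obtain ⟨f, hf⟩ := exists_contMDiffMap_eventuallyEq m
    ((contDiff_taylorTerm q g v).comp
      (contDiff_id.sub (contDiff_const (c := chartAt (EuclideanSpace ℝ (Fin n)) m m))))
  rw [frozenOperator_apply_eq hφ h hm g v hf, modelOperator,
    frozenOperator_apply_eq (IsManifold.chart_mem_maximalAtlas m) (hD m).choose_spec
      (mem_chart_source _ m) g v hf]

theorem isDiffOp_modelOperator [IsManifold (𝓡 n) ∞ M] (hD : IsDiffOp q D) (m : M) :
    IsDiffOp q (modelOperator hD m) := by
  intro v
  refine ⟨fun k w _ => if k = q then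
    (hD m).choose k w (chartAt (EuclideanSpace ℝ (Fin n)) m m) else 0,
    fun k _ w => contDiffOn_const, fun g v' _ => ?_⟩
  rw [modelOperator_apply, Finset.sum_range_succ]
  symm
  rw [Finset.sum_eq_zero, zero_add]
  · simp only [if_true]
    rfl
  · refine fun k hk => Finset.sum_eq_zero fun w _ => ?_
    simp only [if_neg (Finset.mem_range.1 hk).ne, zero_mul]

theorem modelOperator_apply_comp_add [IsManifold (𝓡 n) ∞ M] (hD : IsDiffOp q D) (m : M)
    {g g' : C^∞⟮𝓡 n, EuclideanSpace ℝ (Fin n); ℝ⟯} {X : EuclideanSpace ℝ (Fin n)}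
    (h : ∀ Y, g' Y = g (Y + X)) (Y : EuclideanSpace ℝ (Fin n)) :
    modelOperator hD m g' Y = modelOperator hD m g (Y + X) := by
  rw [modelOperator_apply, modelOperator_apply,
    show (g' : EuclideanSpace ℝ (Fin n) → ℝ) = fun Y => g (Y + X) from funext h]
  simp only [iteratedFDeriv_comp_add_right]

/-- The rescaled operator `s^q D` converges to the model operator along `s ↦ y + s X` on
functions that vanish to order `p`. -/
theorem IsDiffOp.tendsto_modelOperator [IsManifold (𝓡 n) ∞ M] (hD : IsDiffOp q D) {m : M} {p : ℕ}
    (hpq : q ≤ p) {f : C^∞⟮𝓡 n, M; ℝ⟯}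
    (hf : FlatAt p (f ∘ (chartAt (EuclideanSpace ℝ (Fin n)) m).symm)
      (chartAt (EuclideanSpace ℝ (Fin n)) m m))
    (X : EuclideanSpace ℝ (Fin n)) {g : C^∞⟮𝓡 n, EuclideanSpace ℝ (Fin n); ℝ⟯}
    (hg : ∀ Y, g Y = taylorTerm p (f ∘ (chartAt (EuclideanSpace ℝ (Fin n)) m).symm)
      (chartAt (EuclideanSpace ℝ (Fin n)) m m) Y) :
    Filter.Tendsto (fun s : ℝ => (s ^ (p - q))⁻¹ *
        D f ((chartAt (EuclideanSpace ℝ (Fin n)) m).symm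
          (chartAt (EuclideanSpace ℝ (Fin n)) m m + s • X)))
      (𝓝[≠] 0) (𝓝 (modelOperator hD m g X)) := by
  set χ := chartAt (EuclideanSpace ℝ (Fin n)) m with hχ
  have hmt : χ m ∈ χ.target := χ.map_source (mem_chart_source _ m)
  obtain ⟨ha, ha'⟩ := (hD m).choose_spec
  rw [modelOperator_apply, show (g : EuclideanSpace ℝ (Fin n) → ℝ) = _ from funext hg]
  set a := (hD m).choose with hadef
  set F := f ∘ χ.symm with hF
  have hFc : ContDiffAt ℝ ∞ F (χ m) :=
    contDiffAt_comp_symm (IsManifold.chart_mem_maximalAtlas m) f.contMDiff hmt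
  have hpath0 : Filter.Tendsto (fun s : ℝ => χ m + s • X) (𝓝[≠] 0) (𝓝 (χ m)) := by
    have : Continuous fun s : ℝ => χ m + s • X := by fun_prop
    have := this.tendsto 0
    simp only [zero_smul, add_zero] at this
    exact this.mono_left nhdsWithin_le_nhds
  have hs0 : Filter.Tendsto (fun s : ℝ => s) (𝓝[≠] 0) (𝓝 0) :=
    Filter.tendsto_id.mono_left nhdsWithin_le_nhds
  -- The factor `(s ^ (p - q))⁻¹` is split as `s ^ (q - k) * (s ^ (p - k))⁻¹`: the second part makes
  -- the rescaled derivative converge, the first kills the terms with `k < q`.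
  have hlim : Filter.Tendsto (fun s : ℝ => ∑ k ∈ Finset.range (q + 1), ∑ w : Fin k → Fin n,
      a k w (χ m + s • X) * (s ^ (q - k) * ((s ^ (p - k))⁻¹ •
        iteratedFDeriv ℝ k F (χ m + s • X)) fun j => EuclideanSpace.single (w j) 1)) (𝓝[≠] 0)
      (𝓝 (∑ k ∈ Finset.range (q + 1), ∑ w : Fin k → Fin n, a k w (χ m) * (0 ^ (q - k) *
        iteratedFDeriv ℝ k (taylorTerm p F (χ m)) X fun j => EuclideanSpace.single (w j) 1))) := by
    refine tendsto_finsetSum _ fun k hk => tendsto_finsetSum _ fun w _ => ?_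
    have hkq : k ≤ q := Nat.lt_succ_iff.1 (Finset.mem_range.1 hk)
    have hak : ContinuousAt (a k w) (χ m) :=
      (ha k hkq w).continuousOn.continuousAt (χ.open_target.mem_nhds hmt)
    refine (hak.tendsto.comp hpath0).mul ((hs0.pow _).mul ?_)
    have h1 := hf.tendsto_iteratedFDeriv hFc (hkq.trans hpq) X
    have h2 : Continuous fun T : EuclideanSpace ℝ (Fin n) [×k]→L[ℝ] ℝ =>
        T fun j => EuclideanSpace.single (w j) 1 :=
      (ContinuousMultilinearMap.apply ℝ (fun _ : Fin k => EuclideanSpace ℝ (Fin n)) ℝ _).continuous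
    exact (h2.tendsto _).comp h1
  have hval : (∑ k ∈ Finset.range (q + 1), ∑ w : Fin k → Fin n, a k w (χ m) * (0 ^ (q - k) *
        iteratedFDeriv ℝ k (taylorTerm p F (χ m)) X fun j => EuclideanSpace.single (w j) 1))
      = ∑ w : Fin q → Fin n, a q w (χ m) *
        iteratedFDeriv ℝ q (taylorTerm p F (χ m)) X fun j => EuclideanSpace.single (w j) 1 := by
    rw [Finset.sum_range_succ, add_eq_right.2]
    · simp
    · refine Finset.sum_eq_zero fun k hk => Finset.sum_eq_zero fun w _ => ?_
      rw [zero_pow (Nat.sub_ne_zero_of_lt (Finset.mem_range.1 hk))]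
      simp
  rw [hval] at hlim
  refine hlim.congr' ?_
  filter_upwards [self_mem_nhdsWithin, hpath0.eventually (χ.open_target.mem_nhds hmt)] with s hs hst
  have hs' : s ≠ 0 := hs
  rw [ha' f _ (χ.map_target hst), χ.right_inv hst, ← hχ, ← hF, Finset.mul_sum]
  refine Finset.sum_congr rfl fun k hk => ?_
  rw [Finset.mul_sum]
  refine Finset.sum_congr rfl fun w _ => ?_
  have hkq : k ≤ q := Nat.lt_succ_iff.1 (Finset.mem_range.1 hk)
  have hpk : s ^ (p - k) = s ^ (p - q) * s ^ (q - k) := by rw [← pow_add]; congr 1; omega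
  rw [smul_apply, smul_eq_mul, hpk]
  have h1 : s ^ (p - q) ≠ 0 := pow_ne_zero _ hs'
  have h2 : s ^ (q - k) ≠ 0 := pow_ne_zero _ hs'
  field_simp

theorem modelOperator_taylorTerm_eq_zero [IsManifold (𝓡 n) ∞ M] (hD : IsDiffOp q D) (m : M)
    {p : ℕ} (hpq : p < q) {F : EuclideanSpace ℝ (Fin n) → ℝ} {x : EuclideanSpace ℝ (Fin n)}
    (X : EuclideanSpace ℝ (Fin n)) {g : C^∞⟮𝓡 n, EuclideanSpace ℝ (Fin n); ℝ⟯}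
    (hg : ∀ Y, g Y = taylorTerm p F x Y) : modelOperator hD m g X = 0 := by
  rw [modelOperator_apply, show (g : EuclideanSpace ℝ (Fin n) → ℝ) = _ from funext hg]
  refine Finset.sum_eq_zero fun w _ => ?_
  rw [show iteratedFDeriv ℝ q (fun Y => taylorTerm p F x Y) X = 0 from
    iteratedFDeriv_diagonal_eq_zero_of_lt _ hpq X]
  simp

end ModelOperator

/-! ### Operators of finite commutator order -/

section CommutatorOrder

/-- `P` has commutator order at most `q`: its `q + 1`-fold commutators with multiplication operators
vanish. -/
def HasCommutatorOrder {A : Type*} [CommRing A] [Algebra ℝ A] : ℕ → (A →ₗ[ℝ] A) → Prop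
  | 0, P => ∀ g u, P (g * u) = g * P u
  | q + 1, P => ∀ g, HasCommutatorOrder q
      (P ∘ₗ LinearMap.mulLeft ℝ g - LinearMap.mulLeft ℝ g ∘ₗ P)

/-- Double induction on `q` and `p` through `P (g u) = g (P u) + [P, g] u`, where `[P, g]` has
smaller order and `u` lies in a smaller power of `J`. -/
theorem HasCommutatorOrder.map_mem_pow {A : Type*} [CommRing A] [Algebra ℝ A] {q : ℕ}
    {P : A →ₗ[ℝ] A} (hP : HasCommutatorOrder q P) {J : Ideal A} {p : ℕ} {u : A} (hu : u ∈ J ^ p) :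
    P u ∈ J ^ (p - q) := by
  induction q generalizing P p u with
  | zero =>
    have h := hP u 1
    rw [mul_one] at h
    rw [h]
    exact Ideal.mul_mem_right _ _ hu
  | succ q ihq =>
    induction p generalizing u with
    | zero => simp
    | succ p ihp =>
      rw [pow_succ'] at hu
      refine Submodule.mul_induction_on hu (fun g hg u hu => ?_) fun u v hu hv => ?_
      · have h1 : g * P u ∈ J ^ (p - (q + 1) + 1) := by
          rw [pow_succ']
          exact Ideal.mul_mem_mul hg (ihp hu)
        have h2 := ihq (hP g) hu
        have h3 : P (g * u) = g * P u + (P (g * u) - g * P u) := by ring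
        rw [h3, Nat.add_sub_add_right]
        -- With truncated subtraction `p - (q + 1) + 1` is only at least `p - q`, which is the
        -- direction needed.
        exact Ideal.add_mem _ (Ideal.pow_le_pow_right (by omega) h1) h2
      · rw [map_add]
        exact Ideal.add_mem _ hu hv

variable {E : Type*} [NormedAddCommGroup E] [NormedSpace ℝ E] {H : Type*} [TopologicalSpace H]
  {I : ModelWithCorners ℝ E H} {V : Type*} [TopologicalSpace V] [ChartedSpace H V]

/-- At `v` the commutator with `g` is `P` applied to `(g - g(v)) u`, and the factor `g - g(v)`
supplies one more order of vanishing. -/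
theorem hasCommutatorOrder_of_apply_eq_zero {q : ℕ} {P : C^∞⟮I, V; ℝ⟯ →ₗ[ℝ] C^∞⟮I, V; ℝ⟯}
    (hP : ∀ v, ∀ u ∈ smoothVanishingIdeal I {v} ^ (q + 1), P u v = 0) :
    HasCommutatorOrder q P := by
  have key : ∀ (P : C^∞⟮I, V; ℝ⟯ →ₗ[ℝ] C^∞⟮I, V; ℝ⟯) (g u : C^∞⟮I, V; ℝ⟯) (v : V),
      (P (g * u) - g * P u) v = P ((g - algebraMap ℝ _ (g v)) * u) v := by
    intro P g u v
    rw [sub_mul, map_sub, ← Algebra.smul_def, map_smul]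
    rfl
  have hmem : ∀ (g : C^∞⟮I, V; ℝ⟯) (v : V),
      g - algebraMap ℝ _ (g v) ∈ smoothVanishingIdeal I {v} := by
    rintro g v _ rfl
    exact sub_self _
  induction q generalizing P with
  | zero =>
    intro g u
    rw [← sub_eq_zero]
    ext v
    rw [key]
    refine hP v _ ?_
    rw [zero_add, pow_one]
    exact Ideal.mul_mem_right _ _ (hmem g v)
  | succ q ih =>
    intro g
    refine ih fun v u hu => (key P g u v).trans (hP v _ ?_)
    rw [pow_succ']
    exact Ideal.mul_mem_mul (hmem g v) hu

end CommutatorOrder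

/-! ### Operators in the first variable -/

section PartialOperator

variable {n : ℕ} {M : Type u} [TopologicalSpace M] [ChartedSpace (EuclideanSpace ℝ (Fin n)) M]

/-- The restriction of smooth functions on `M × M` to `M × {m₂}`. -/
def slice (m₂ : M) : C^∞⟮(𝓡 n).prod (𝓡 n), M × M; ℝ⟯ →ₐ[ℝ] C^∞⟮𝓡 n, M; ℝ⟯ where
  toFun f := ⟨fun m₁ => f (m₁, m₂), f.contMDiff.comp (contMDiff_id.prodMk contMDiff_const)⟩
  map_one' := rfl
  map_mul' _ _ := rfl
  map_zero' := rfl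
  map_add' _ _ := rfl
  commutes' _ := rfl

/-- Restriction is a ring homomorphism and respects powers of ideals. The set `S` is the diagonal
when orders of vanishing are compared, and a single point when the commutator order of `D ⊗ 1` is
computed. -/
theorem slice_mem_pow {m₁ m₂ : M} {S : Set (M × M)} (hS : (m₁, m₂) ∈ S) {p : ℕ}
    {u : C^∞⟮(𝓡 n).prod (𝓡 n), M × M; ℝ⟯}
    (hu : u ∈ smoothVanishingIdeal ((𝓡 n).prod (𝓡 n)) S ^ p) :
    slice m₂ u ∈ smoothVanishingIdeal (𝓡 n) {m₁} ^ p := by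
  have h1 : Ideal.map (slice m₂) (smoothVanishingIdeal ((𝓡 n).prod (𝓡 n)) S)
      ≤ smoothVanishingIdeal (𝓡 n) {m₁} := by
    rw [Ideal.map_le_iff_le_comap]
    rintro g hg _ rfl
    exact hg _ hS
  have h2 := Ideal.mem_map_of_mem (slice m₂) hu
  rw [Ideal.map_pow] at h2
  exact Ideal.pow_right_mono h1 p h2

theorem slice_eventuallyEq {m₁ m₂ : M} {f g : C^∞⟮(𝓡 n).prod (𝓡 n), M × M; ℝ⟯}
    (h : (f : M × M → ℝ) =ᶠ[𝓝 (m₁, m₂)] g) : (slice m₂ f : M → ℝ) =ᶠ[𝓝 m₁] slice m₂ g := by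
  have hc : Filter.Tendsto (fun m : M => (m, m₂)) (𝓝 m₁) (𝓝 (m₁, m₂)) :=
    (Continuous.prodMk continuous_id continuous_const).tendsto m₁
  exact hc.eventually h

theorem flatAt_slice [IsManifold (𝓡 n) ∞ M] {p : ℤ} {f : C^∞⟮(𝓡 n).prod (𝓡 n), M × M; ℝ⟯}
    (hf : VanishesToOrder ((𝓡 n).prod (𝓡 n)) (Set.diagonal M) p f) (m : M) :
    FlatAt p.toNat (slice m f ∘ (chartAt (EuclideanSpace ℝ (Fin n)) m).symm)
      (chartAt (EuclideanSpace ℝ (Fin n)) m m) := by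
  obtain ⟨u, hu, hfu⟩ := hf (m, m)
  have h1 : slice m u ∈ smoothVanishingIdeal (𝓡 n) {m} ^ p.toNat :=
    slice_mem_pow (Set.mem_diagonal m) hu
  exact (flatAt_of_mem_pow h1).congr
    (eventuallyEq_comp_symm (mem_chart_source _ m) (slice_eventuallyEq hfu))

/-- Derivatives of a slice are partial derivatives of a function of both variables, which makes
their smooth dependence on the slice visible. -/
theorem iteratedFDeriv_slice [IsManifold (𝓡 n) ∞ M] (f : C^∞⟮(𝓡 n).prod (𝓡 n), M × M; ℝ⟯)
    {χ ψ : OpenPartialHomeomorph M (EuclideanSpace ℝ (Fin n))}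
    (hχ : χ ∈ IsManifold.maximalAtlas (𝓡 n) ∞ M) (hψ : ψ ∈ IsManifold.maximalAtlas (𝓡 n) ∞ M)
    {y y' : EuclideanSpace ℝ (Fin n)} (hy : y ∈ χ.target) (hy' : y' ∈ ψ.target) (k : ℕ)
    (v : Fin k → EuclideanSpace ℝ (Fin n)) :
    ContDiffAt ℝ ∞ (fun z : EuclideanSpace ℝ (Fin n) × EuclideanSpace ℝ (Fin n) =>
      f (χ.symm z.1, ψ.symm z.2)) (y, y') ∧
    iteratedFDeriv ℝ k (slice (ψ.symm y') f ∘ χ.symm) y v =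
      iteratedFDeriv ℝ k (fun z : EuclideanSpace ℝ (Fin n) × EuclideanSpace ℝ (Fin n) =>
        f (χ.symm z.1, ψ.symm z.2)) (y, y') fun j => (v j, 0) := by
  have h1 : ContMDiffAt 𝓘(ℝ, EuclideanSpace ℝ (Fin n) × EuclideanSpace ℝ (Fin n)) (𝓡 n) ∞
      (fun z : EuclideanSpace ℝ (Fin n) × EuclideanSpace ℝ (Fin n) => χ.symm z.1) (y, y') :=
    ContMDiffAt.comp (y, y') (contMDiffAt_symm_of_mem_maximalAtlas hχ hy)
      contDiff_fst.contMDiff.contMDiffAt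
  have h2 : ContMDiffAt 𝓘(ℝ, EuclideanSpace ℝ (Fin n) × EuclideanSpace ℝ (Fin n)) (𝓡 n) ∞
      (fun z : EuclideanSpace ℝ (Fin n) × EuclideanSpace ℝ (Fin n) => ψ.symm z.2) (y, y') :=
    ContMDiffAt.comp (y, y') (contMDiffAt_symm_of_mem_maximalAtlas hψ hy')
      contDiff_snd.contMDiff.contMDiffAt
  have hG : ContDiffAt ℝ ∞ (fun z : EuclideanSpace ℝ (Fin n) × EuclideanSpace ℝ (Fin n) =>
      f (χ.symm z.1, ψ.symm z.2)) (y, y') :=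
    (f.contMDiff.contMDiffAt.comp (y, y') (h1.prodMk h2)).contDiffAt
  refine ⟨hG, ?_⟩
  have h3 := iteratedFDeriv_comp_affine (k := k)
    (g := fun z : EuclideanSpace ℝ (Fin n) × EuclideanSpace ℝ (Fin n) =>
      f (χ.symm z.1, ψ.symm z.2))
    (ContinuousLinearMap.inl ℝ (EuclideanSpace ℝ (Fin n)) (EuclideanSpace ℝ (Fin n))) (0, y')
    (x := y) (by simpa using hG.of_le (by exact_mod_cast le_top)) v
  simp only [ContinuousLinearMap.inl_apply, Prod.mk_add_mk, add_zero, zero_add] at h3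
  exact h3

theorem TangentGroupoid.inv_factorial_mul_iteratedDerivAlong [IsManifold (𝓡 n) ∞ M] (p : ℕ)
    (f : C^∞⟮(𝓡 n).prod (𝓡 n), M × M; ℝ⟯) (m : M) (X : EuclideanSpace ℝ (Fin n)) :
    (p.factorial : ℝ)⁻¹ * TangentGroupoid.iteratedDerivAlong (n := n) p f m X
      = taylorTerm p (slice m f ∘ (chartAt (EuclideanSpace ℝ (Fin n)) m).symm)
        (chartAt (EuclideanSpace ℝ (Fin n)) m m) X := by
  set χ := chartAt (EuclideanSpace ℝ (Fin n)) m with hχ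
  have hm := χ.map_source (mem_chart_source _ m)
  have h := (iteratedFDeriv_slice f (IsManifold.chart_mem_maximalAtlas m)
    (IsManifold.chart_mem_maximalAtlas m) hm hm p fun _ => X).2
  rw [← hχ, χ.left_inv (mem_chart_source _ m)] at h
  rw [taylorTerm, smul_apply, smul_eq_mul, h]
  rfl

variable {q : ℕ} {D : C^∞⟮𝓡 n, M; ℝ⟯ →ₗ[ℝ] C^∞⟮𝓡 n, M; ℝ⟯}

theorem IsDiffOp.contMDiff_slice [IsManifold (𝓡 n) ∞ M] (hD : IsDiffOp q D)
    (f : C^∞⟮(𝓡 n).prod (𝓡 n), M × M; ℝ⟯) :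
    ContMDiff ((𝓡 n).prod (𝓡 n)) 𝓘(ℝ, ℝ) ∞ fun v : M × M => D (slice v.2 f) v.1 := by
  rintro ⟨m₁, m₂⟩
  set χ := chartAt (EuclideanSpace ℝ (Fin n)) m₁ with hχ
  set ψ := chartAt (EuclideanSpace ℝ (Fin n)) m₂ with hψ
  have hχa : χ ∈ IsManifold.maximalAtlas (𝓡 n) ∞ M := IsManifold.chart_mem_maximalAtlas m₁
  have hψa : ψ ∈ IsManifold.maximalAtlas (𝓡 n) ∞ M := IsManifold.chart_mem_maximalAtlas m₂
  have hm₁ : m₁ ∈ χ.source := mem_chart_source _ m₁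
  have hm₂ : m₂ ∈ ψ.source := mem_chart_source _ m₂
  obtain ⟨a, ha, ha'⟩ := hD m₁
  set G := fun z : EuclideanSpace ℝ (Fin n) × EuclideanSpace ℝ (Fin n) =>
    f (χ.symm z.1, ψ.symm z.2) with hG
  have hGc : ContDiffAt ℝ ∞ G (χ m₁, ψ m₂) :=
    (iteratedFDeriv_slice f hχa hψa (χ.map_source hm₁) (ψ.map_source hm₂) 0 0).1
  have hχc : ContMDiffAt ((𝓡 n).prod (𝓡 n)) (𝓡 n) ∞ (fun v : M × M => χ v.1) (m₁, m₂) :=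
    ContMDiffAt.comp (m₁, m₂) (contMDiffAt_of_mem_maximalAtlas hχa hm₁) contMDiffAt_fst
  have hψc : ContMDiffAt ((𝓡 n).prod (𝓡 n)) (𝓡 n) ∞ (fun v : M × M => ψ v.2) (m₁, m₂) :=
    ContMDiffAt.comp (m₁, m₂) (contMDiffAt_of_mem_maximalAtlas hψa hm₂) contMDiffAt_snd
  have hsum : ContMDiffAt ((𝓡 n).prod (𝓡 n)) 𝓘(ℝ, ℝ) ∞ (fun v : M × M =>
      ∑ k ∈ Finset.range (q + 1), ∑ w : Fin k → Fin n, a k w (χ v.1) *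
        iteratedFDeriv ℝ k G (χ v.1, ψ v.2) fun j => (EuclideanSpace.single (w j) 1, 0))
      (m₁, m₂) := by
    refine ContMDiffAt.sum fun k hk => ContMDiffAt.sum fun w _ => ContMDiffAt.mul ?_ ?_
    · have hak : ContDiffAt ℝ ∞ (a k w) (χ m₁) :=
        (ha k (Nat.lt_succ_iff.1 (Finset.mem_range.1 hk)) w).contDiffAt
          (χ.open_target.mem_nhds (χ.map_source hm₁))
      exact ContMDiffAt.comp (m₁, m₂) hak.contMDiffAt hχc
    · have h1 : ContDiffAt ℝ ∞ (iteratedFDeriv ℝ k G) (χ m₁, ψ m₂) :=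
        hGc.iteratedFDeriv_right (by norm_cast)
      have h2 : ContDiffAt ℝ ∞ (fun z => iteratedFDeriv ℝ k G z fun j =>
          (EuclideanSpace.single (w j) 1, 0)) (χ m₁, ψ m₂) :=
        (ContinuousMultilinearMap.apply ℝ (fun _ : Fin k => EuclideanSpace ℝ (Fin n) ×
          EuclideanSpace ℝ (Fin n)) ℝ _).contDiff.contDiffAt.comp _ h1
      exact ContMDiffAt.comp (m₁, m₂) h2.contMDiffAt (hχc.prodMk_space hψc)
  refine hsum.congr_of_eventuallyEq ?_
  have hU : χ.source ×ˢ ψ.source ∈ 𝓝 (m₁, m₂) :=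
    prod_mem_nhds (χ.open_source.mem_nhds hm₁) (ψ.open_source.mem_nhds hm₂)
  filter_upwards [hU] with v hv
  rw [ha' _ _ hv.1]
  refine Finset.sum_congr rfl fun k _ => Finset.sum_congr rfl fun w _ => ?_
  have h := (iteratedFDeriv_slice f hχa hψa (χ.map_source hv.1) (ψ.map_source hv.2) k
    fun j => EuclideanSpace.single (w j) 1).2
  rw [ψ.left_inv hv.2] at h
  rw [h]

/-- The operator `D ⊗ 1` on `M × M`, acting in the first variable. -/
def IsDiffOp.partialOp [IsManifold (𝓡 n) ∞ M] (hD : IsDiffOp q D) :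
    C^∞⟮(𝓡 n).prod (𝓡 n), M × M; ℝ⟯ →ₗ[ℝ] C^∞⟮(𝓡 n).prod (𝓡 n), M × M; ℝ⟯ where
  toFun f := ⟨fun v => D (slice v.2 f) v.1, hD.contMDiff_slice f⟩
  map_add' f g := by
    ext v
    change D (slice v.2 (f + g)) v.1 = D (slice v.2 f) v.1 + D (slice v.2 g) v.1
    rw [map_add, map_add]
    rfl
  map_smul' c f := by
    ext v
    change D (slice v.2 (c • f)) v.1 = c * D (slice v.2 f) v.1
    rw [map_smul, map_smul]
    rfl

theorem IsDiffOp.hasCommutatorOrder_partialOp [IsManifold (𝓡 n) ∞ M] (hD : IsDiffOp q D) :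
    HasCommutatorOrder q hD.partialOp :=
  hasCommutatorOrder_of_apply_eq_zero fun v _ hu =>
    hD.apply_eq_zero_of_mem_pow (slice_mem_pow (Set.mem_singleton v) hu)

theorem IsDiffOp.vanishesToOrder_partialOp [IsManifold (𝓡 n) ∞ M] (hD : IsDiffOp q D)
    {S : Set (M × M)} {p : ℤ} {f : C^∞⟮(𝓡 n).prod (𝓡 n), M × M; ℝ⟯}
    (hf : VanishesToOrder ((𝓡 n).prod (𝓡 n)) S p f) :
    VanishesToOrder ((𝓡 n).prod (𝓡 n)) S (p - q) (hD.partialOp f) := by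
  intro v
  obtain ⟨u, hu, hfu⟩ := hf v
  refine ⟨hD.partialOp u, ?_, ?_⟩
  · rw [show (p - q).toNat = p.toNat - q by omega]
    exact hD.hasCommutatorOrder_partialOp.map_mem_pow hu
  -- Locality of `D` needs equality of germs at each point near `v`, not only at `v`.
  · filter_upwards [hfu.eventuallyEq_nhds] with v' hv'
    exact hD.apply_congr (slice_eventuallyEq hv')

end PartialOperator

namespace TangentGroupoid

section Evaluation

variable {n : ℕ} {M : Type u} [TopologicalSpace M] [ChartedSpace (EuclideanSpace ℝ (Fin n)) M]

/-! ### The evaluations are characters -/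

/-- Evaluation of Laurent polynomials over `C^∞(M × M)` at a point of `M × M × ℝˣ`. -/
def evalPairHom (m₁ m₂ : M) (l : ℝ) (hl : l ≠ 0) :
    C^∞⟮(𝓡 n).prod (𝓡 n), M × M; ℝ⟯[T;T⁻¹] →+* ℝ :=
  LaurentPolynomial.eval₂ (ContMDiffMap.evalRingHom (m₁, m₂)) (Units.mk0 l hl)

theorem evalPairHom_apply (m₁ m₂ : M) (l : ℝ) (hl : l ≠ 0)
    (a : C^∞⟮(𝓡 n).prod (𝓡 n), M × M; ℝ⟯[T;T⁻¹]) :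
    evalPairHom m₁ m₂ l hl a = a.coeff.sum fun i f => f (m₁, m₂) * l ^ i := by
  conv_lhs => rw [← AddMonoidAlgebra.sum_coeff_single a]
  rw [Finsupp.sum, map_sum]
  refine Finset.sum_congr rfl fun i _ => ?_
  rw [LaurentPolynomial.single_eq_C_mul_T, evalPairHom, LaurentPolynomial.eval₂_C_mul_T]
  simp only [Units.val_zpow_eq_zpow_val, Units.val_mk0]
  rfl

theorem eval_pair (a : tangentAlgebra n M) (m₁ m₂ : M) (l : ℝ) (hl : l ≠ 0) :
    eval a (pair m₁ m₂ l hl) = evalPairHom m₁ m₂ l hl a.1 :=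
  (evalPairHom_apply m₁ m₂ l hl _).symm

theorem eval_tangent [IsManifold (𝓡 n) ∞ M] (a : tangentAlgebra n M) (m : M)
    (X : EuclideanSpace ℝ (Fin n)) :
    eval a (tangent m X) = (a : C^∞⟮(𝓡 n).prod (𝓡 n), M × M; ℝ⟯[T;T⁻¹]).coeff.sum fun i f =>
      if i ≤ 0 then taylorTerm (-i).toNat
        (slice m f ∘ (chartAt (EuclideanSpace ℝ (Fin n)) m).symm)
        (chartAt (EuclideanSpace ℝ (Fin n)) m m) X else 0 := by
  simp only [← inv_factorial_mul_iteratedDerivAlong]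
  rfl

theorem tendsto_chart_path (m : M) (X : EuclideanSpace ℝ (Fin n)) :
    Filter.Tendsto (fun s : ℝ => (chartAt (EuclideanSpace ℝ (Fin n)) m).symm
      (chartAt (EuclideanSpace ℝ (Fin n)) m m + s • X)) (𝓝[≠] 0) (𝓝 m) := by
  set χ := chartAt (EuclideanSpace ℝ (Fin n)) m with hχ
  have hpath : Filter.Tendsto (fun s : ℝ => χ m + s • X) (𝓝[≠] 0) (𝓝 (χ m)) := by
    have : Continuous fun s : ℝ => χ m + s • X := by fun_prop
    have := this.tendsto 0
    simp only [zero_smul, add_zero] at this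
    exact this.mono_left nhdsWithin_le_nhds
  have h := (χ.continuousAt_symm (χ.map_source (mem_chart_source _ m))).tendsto
  rw [χ.left_inv (mem_chart_source _ m)] at h
  exact h.comp hpath

/-- The value at a tangent vector is the limit of the values along the curve of pairs that it
generates. -/
theorem tendsto_eval_tangent [IsManifold (𝓡 n) ∞ M] (a : tangentAlgebra n M) (m : M)
    (X : EuclideanSpace ℝ (Fin n)) :
    Filter.Tendsto (fun s : ℝ =>
      (a : C^∞⟮(𝓡 n).prod (𝓡 n), M × M; ℝ⟯[T;T⁻¹]).coeff.sum fun i f =>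
        f ((chartAt (EuclideanSpace ℝ (Fin n)) m).symm
          (chartAt (EuclideanSpace ℝ (Fin n)) m m + s • X), m) * s ^ i)
      (𝓝[≠] 0) (𝓝 (eval a (tangent m X))) := by
  rw [eval_tangent]
  refine tendsto_finsetSum _ fun i _ => ?_
  set f := (a : C^∞⟮(𝓡 n).prod (𝓡 n), M × M; ℝ⟯[T;T⁻¹]).coeff i with hf
  have hs0 : Filter.Tendsto (fun s : ℝ => s) (𝓝[≠] 0) (𝓝 0) :=
    Filter.tendsto_id.mono_left nhdsWithin_le_nhds
  dsimp only
  by_cases hi : i ≤ 0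
  -- For the exponent `-p` this is the rescaling limit with `k = 0`, for a function flat to order
  -- `p`.
  · rw [if_pos hi]
    have hv : VanishesToOrder ((𝓡 n).prod (𝓡 n)) (Set.diagonal M) (-i) f := by
      have := a.2 (-i)
      rwa [neg_neg] at this
    have hc := contDiffAt_comp_symm (IsManifold.chart_mem_maximalAtlas (I := 𝓡 n) (n := ∞) m)
      (slice m f).contMDiff ((chartAt (EuclideanSpace ℝ (Fin n)) m).map_source
        (mem_chart_source _ m))
    have h1 := (flatAt_slice hv m).tendsto_iteratedFDeriv hc (Nat.zero_le _) X
    have h2 : Continuous fun T : EuclideanSpace ℝ (Fin n) [×0]→L[ℝ] ℝ => T 0 :=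
      (ContinuousMultilinearMap.apply ℝ (fun _ : Fin 0 => EuclideanSpace ℝ (Fin n)) ℝ 0).continuous
    refine ((h2.tendsto _).comp h1).congr fun s => ?_
    rw [Function.comp_apply, smul_apply, iteratedFDeriv_zero_apply, smul_eq_mul, mul_comm]
    congr 1
    obtain ⟨p, rfl⟩ : ∃ p : ℕ, i = -p := ⟨(-i).toNat, by omega⟩
    simp
  · rw [if_neg hi]
    have h1 : Filter.Tendsto (fun s : ℝ => s ^ i) (𝓝[≠] 0) (𝓝 0) := by
      obtain ⟨p, rfl⟩ : ∃ p : ℕ, i = p := ⟨i.toNat, by omega⟩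
      have hp : p ≠ 0 := by omega
      simpa [hp] using hs0.pow p
    have h2 : Filter.Tendsto (fun s : ℝ => f ((chartAt (EuclideanSpace ℝ (Fin n)) m).symm
        (chartAt (EuclideanSpace ℝ (Fin n)) m m + s • X), m)) (𝓝[≠] 0) (𝓝 (f (m, m))) :=
      (f.contMDiff.continuous.tendsto (m, m)).comp
        ((tendsto_chart_path m X).prodMk_nhds tendsto_const_nhds)
    simpa using h2.mul h1

/-- The same limit with ring homomorphisms under the limit sign, so that multiplicativity passes to
tangent vectors. The value at `s = 0` plays no role. -/
theorem tendsto_evalPairHom [IsManifold (𝓡 n) ∞ M] (a : tangentAlgebra n M) (m : M)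
    (X : EuclideanSpace ℝ (Fin n)) :
    Filter.Tendsto (fun s : ℝ => if hs : s ≠ 0 then
        evalPairHom ((chartAt (EuclideanSpace ℝ (Fin n)) m).symm
          (chartAt (EuclideanSpace ℝ (Fin n)) m m + s • X)) m s hs a.1 else 0)
      (𝓝[≠] 0) (𝓝 (eval a (tangent m X))) := by
  refine (tendsto_eval_tangent a m X).congr' ?_
  filter_upwards [self_mem_nhdsWithin] with s hs
  have hs' : s ≠ 0 := hs
  rw [dif_pos hs', evalPairHom_apply]

/-- The points of `𝕋M` are characters of `A(𝕋M)`. -/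
def evalHom [IsManifold (𝓡 n) ∞ M] : TangentGroupoid n M → tangentAlgebra n M →+* ℝ
  | tangent m X =>
    { toFun := fun a => eval a (tangent m X)
      map_one' := tendsto_nhds_unique (tendsto_evalPairHom 1 m X) <| by
        refine tendsto_const_nhds.congr' ?_
        filter_upwards [self_mem_nhdsWithin] with s hs
        have hs' : s ≠ 0 := hs
        rw [dif_pos hs', OneMemClass.coe_one, map_one]
      map_mul' := fun a b => tendsto_nhds_unique (tendsto_evalPairHom (a * b) m X) <| by
        refine ((tendsto_evalPairHom a m X).mul (tendsto_evalPairHom b m X)).congr' ?_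
        filter_upwards [self_mem_nhdsWithin] with s hs
        have hs' : s ≠ 0 := hs
        rw [dif_pos hs', dif_pos hs', dif_pos hs', MulMemClass.coe_mul, map_mul]
      map_zero' := tendsto_nhds_unique (tendsto_evalPairHom 0 m X) <| by
        refine tendsto_const_nhds.congr' ?_
        filter_upwards [self_mem_nhdsWithin] with s hs
        have hs' : s ≠ 0 := hs
        rw [dif_pos hs', ZeroMemClass.coe_zero, map_zero]
      map_add' := fun a b => tendsto_nhds_unique (tendsto_evalPairHom (a + b) m X) <| by
        refine ((tendsto_evalPairHom a m X).add (tendsto_evalPairHom b m X)).congr' ?_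
        filter_upwards [self_mem_nhdsWithin] with s hs
        have hs' : s ≠ 0 := hs
        rw [dif_pos hs', dif_pos hs', dif_pos hs', AddMemClass.coe_add, map_add] }
  | pair m₁ m₂ l hl => (evalPairHom m₁ m₂ l hl).comp (tangentAlgebra n M).val.toRingHom

theorem evalHom_apply [IsManifold (𝓡 n) ∞ M] (γ : TangentGroupoid n M) (a : tangentAlgebra n M) :
    evalHom γ a = eval a γ := by
  cases γ with
  | tangent m X => rfl
  | pair m₁ m₂ l hl => exact (eval_pair a m₁ m₂ l hl).symm

theorem eval_zero [IsManifold (𝓡 n) ∞ M] (γ : TangentGroupoid n M) :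
    eval (0 : tangentAlgebra n M) γ = 0 := by
  rw [← evalHom_apply, map_zero]

theorem eval_add [IsManifold (𝓡 n) ∞ M] (a b : tangentAlgebra n M) (γ : TangentGroupoid n M) :
    eval (a + b) γ = eval a γ + eval b γ := by
  simp only [← evalHom_apply, map_add]

/-! ### The action of a differential operator on `A(𝕋M)` -/

/-- The monomial `f t^i`. -/
def tangentMonomial (i : ℤ) (f : C^∞⟮(𝓡 n).prod (𝓡 n), M × M; ℝ⟯)
    (hf : VanishesToOrder ((𝓡 n).prod (𝓡 n)) (Set.diagonal M) (-i) f) : tangentAlgebra n M :=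
  ⟨AddMonoidAlgebra.single i f, fun p => by
    rw [AddMonoidAlgebra.coeff_single, Finsupp.single_apply]
    split_ifs with h
    · rwa [show p = -i by omega]
    · exact VanishesToOrder.zero _ _⟩

/-- Vanishing is required of each coefficient separately, so the monomials of an element of `A(𝕋M)`
again lie in `A(𝕋M)`. -/
theorem tangentAlgebra_induction {Q : tangentAlgebra n M → Prop} (h0 : Q 0)
    (hadd : ∀ a b, Q a → Q b → Q (a + b)) (hmon : ∀ i f hf, Q (tangentMonomial i f hf))
    (a : tangentAlgebra n M) : Q a := by
  have hv : ∀ i, VanishesToOrder ((𝓡 n).prod (𝓡 n)) (Set.diagonal M) (-i)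
      ((a : C^∞⟮(𝓡 n).prod (𝓡 n), M × M; ℝ⟯[T;T⁻¹]).coeff i) := fun i => by
    have := a.2 (-i)
    rwa [neg_neg] at this
  have ha : a = ∑ i ∈ (a : C^∞⟮(𝓡 n).prod (𝓡 n), M × M; ℝ⟯[T;T⁻¹]).coeff.support,
      tangentMonomial i _ (hv i) := by
    apply Subtype.ext
    rw [AddSubmonoidClass.coe_finsetSum]
    exact (AddMonoidAlgebra.sum_coeff_single _).symm
  rw [ha]
  exact Finset.sum_induction _ Q hadd h0 fun i _ => hmon _ _ _

theorem eval_tangentMonomial_pair (i : ℤ) (f : C^∞⟮(𝓡 n).prod (𝓡 n), M × M; ℝ⟯)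
    (hf : VanishesToOrder ((𝓡 n).prod (𝓡 n)) (Set.diagonal M) (-i) f) (m₁ m₂ : M) (l : ℝ)
    (hl : l ≠ 0) : eval (tangentMonomial i f hf) (pair m₁ m₂ l hl) = f (m₁, m₂) * l ^ i :=
  Finsupp.sum_single_index (h := fun i (f : C^∞⟮(𝓡 n).prod (𝓡 n), M × M; ℝ⟯) =>
    f (m₁, m₂) * l ^ i) (zero_mul _)

theorem eval_tangentMonomial_tangent [IsManifold (𝓡 n) ∞ M] (i : ℤ)
    (f : C^∞⟮(𝓡 n).prod (𝓡 n), M × M; ℝ⟯)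
    (hf : VanishesToOrder ((𝓡 n).prod (𝓡 n)) (Set.diagonal M) (-i) f) (m : M)
    (X : EuclideanSpace ℝ (Fin n)) :
    eval (tangentMonomial i f hf) (tangent m X) = if i ≤ 0 then taylorTerm (-i).toNat
      (slice m f ∘ (chartAt (EuclideanSpace ℝ (Fin n)) m).symm)
      (chartAt (EuclideanSpace ℝ (Fin n)) m m) X else 0 := by
  rw [eval_tangent]
  refine Finsupp.sum_single_index ?_
  split_ifs
  · rw [taylorTerm, map_zero, show ((0 : C^∞⟮𝓡 n, M; ℝ⟯) : M → ℝ) ∘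
      (chartAt (EuclideanSpace ℝ (Fin n)) m).symm = fun _ => (0 : ℝ) from rfl]
    simp
  · rfl

/-- The restriction of an element of `A(𝕋M)` to a source fiber over a nonzero parameter. -/
def pairFiber (m₂ : M) (l : ℝ) (hl : l ≠ 0) (a : tangentAlgebra n M) : C^∞⟮𝓡 n, M; ℝ⟯ :=
  ⟨fun m₁ => eval a (pair m₁ m₂ l hl), contMDiff_eval_pair a m₂ l hl⟩

/-- The restriction of an element of `A(𝕋M)` to a tangent space. -/
def tangentFiber (m : M) (a : tangentAlgebra n M) : C^∞⟮𝓡 n, EuclideanSpace ℝ (Fin n); ℝ⟯ :=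
  ⟨fun X => eval a (tangent m X), contMDiff_eval_tangent a m⟩

variable {q : ℕ} {D : C^∞⟮𝓡 n, M; ℝ⟯ →ₗ[ℝ] C^∞⟮𝓡 n, M; ℝ⟯}

/-- The operators `λ^q D` and `D_m` preserve the restrictions of `A(𝕋M)`: they act by
`f t^{-p} ↦ (D ⊗ 1) f t^{-(p - q)}`. -/
theorem exists_eval_eq_apply [IsManifold (𝓡 n) ∞ M] (hD : IsDiffOp q D) (a : tangentAlgebra n M) :
    ∃ b : tangentAlgebra n M,
      (∀ m₁ m₂ l hl, eval b (pair m₁ m₂ l hl) = l ^ q * D (pairFiber m₂ l hl a) m₁) ∧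
      ∀ m (X : EuclideanSpace ℝ (Fin n)),
        eval b (tangent m X) = modelOperator hD m (tangentFiber m a) X := by
  induction a using tangentAlgebra_induction with
  | h0 =>
    refine ⟨0, fun m₁ m₂ l hl => ?_, fun m X => ?_⟩
    · have h : pairFiber m₂ l hl (0 : tangentAlgebra n M) = 0 := by
        ext m
        exact eval_zero (n := n) (pair m m₂ l hl)
      rw [h, map_zero, eval_zero]
      simp
    · have h : tangentFiber m (0 : tangentAlgebra n M) = 0 := by
        ext Y
        exact eval_zero (n := n) (tangent m Y)
      rw [h, map_zero, eval_zero]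
      rfl
  | hadd a a' ha ha' =>
    obtain ⟨b, hb₁, hb₂⟩ := ha
    obtain ⟨b', hb₁', hb₂'⟩ := ha'
    refine ⟨b + b', fun m₁ m₂ l hl => ?_, fun m X => ?_⟩
    · have h : pairFiber m₂ l hl (a + a') = pairFiber m₂ l hl a + pairFiber m₂ l hl a' := by
        ext m
        exact eval_add a a' (pair m m₂ l hl)
      rw [h, map_add, eval_add, hb₁, hb₁',
        ContMDiffMap.coe_add, Pi.add_apply, mul_add]
    · have h : tangentFiber m (a + a') = tangentFiber m a + tangentFiber m a' := by
        ext Y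
        exact eval_add a a' (tangent m Y)
      rw [h, map_add, eval_add, hb₂, hb₂',
        ContMDiffMap.coe_add, Pi.add_apply]
  | hmon i f hf =>
    have hDf : VanishesToOrder ((𝓡 n).prod (𝓡 n)) (Set.diagonal M) (-(i + q)) (hD.partialOp f) := by
      have := hD.vanishesToOrder_partialOp hf
      rwa [show -i - (q : ℤ) = -(i + q) by ring] at this
    refine ⟨tangentMonomial (i + q) (hD.partialOp f) hDf, fun m₁ m₂ l hl => ?_, fun m X => ?_⟩
    · have h : pairFiber m₂ l hl (tangentMonomial i f hf) = l ^ i • slice m₂ f := by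
        ext m
        exact (eval_tangentMonomial_pair i f hf m m₂ l hl).trans (mul_comm _ _)
      rw [h, map_smul, eval_tangentMonomial_pair, ContMDiffMap.coe_smul, Pi.smul_apply,
        smul_eq_mul, zpow_add₀ hl, zpow_natCast]
      change D (slice m₂ f) m₁ * _ = _
      ring
    · rw [eval_tangentMonomial_tangent]
      -- The order of vanishing is `-i`. If `-i ≥ q`, both sides are limits of one function of `s`.
      -- If `0 ≤ -i < q`, both sides are zero, since `D_m` kills polynomials of degree below `q`. If
      -- `-i < 0`, the monomial already restricts to zero on `T_m M`.
      by_cases hi : i ≤ 0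
      · have hg : ∀ Y, tangentFiber m (tangentMonomial i f hf) Y = taylorTerm (-i).toNat
            (slice m f ∘ (chartAt (EuclideanSpace ℝ (Fin n)) m).symm)
            (chartAt (EuclideanSpace ℝ (Fin n)) m m) Y := fun Y =>
          (eval_tangentMonomial_tangent i f hf m Y).trans (if_pos hi)
        by_cases hiq : i + q ≤ 0
        · rw [if_pos hiq]
          have h1 := hD.tendsto_modelOperator (p := (-i).toNat) (by omega) (flatAt_slice hf m) X hg
          have h2 := tendsto_eval_tangent (tangentMonomial (i + q) (hD.partialOp f) hDf) m X
          rw [eval_tangentMonomial_tangent, if_pos hiq] at h2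
          refine tendsto_nhds_unique h2 (h1.congr fun s => ?_)
          refine Eq.trans ?_ (Finsupp.sum_single_index
            (h := fun i (f : C^∞⟮(𝓡 n).prod (𝓡 n), M × M; ℝ⟯) =>
              f ((chartAt (EuclideanSpace ℝ (Fin n)) m).symm
                (chartAt (EuclideanSpace ℝ (Fin n)) m m + s • X), m) * s ^ i) (zero_mul _)).symm
          rw [mul_comm]
          congr 1
          obtain ⟨p, rfl⟩ : ∃ p : ℕ, i = -(p + q : ℕ) := ⟨(-i).toNat - q, by omega⟩
          have e1 : (-(-((p + q : ℕ) : ℤ))).toNat - q = p := by omega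
          have e2 : -((p + q : ℕ) : ℤ) + q = -p := by push_cast; ring
          rw [e1, e2, zpow_neg, zpow_natCast]
        · rw [if_neg hiq, modelOperator_taylorTerm_eq_zero hD m (by omega) X hg]
      · have h : tangentFiber m (tangentMonomial i f hf) = 0 := by
          ext Y
          exact (eval_tangentMonomial_tangent i f hf m Y).trans (if_neg hi)
        rw [h, map_zero, if_neg (by omega)]
        rfl

end Evaluation

section SmoothFunctions

variable {n : ℕ} {M : Type u} [TopologicalSpace M] [ChartedSpace (EuclideanSpace ℝ (Fin n)) M]

/-! ### Smooth functions on the tangent groupoid -/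

/-- Smoothness of a function on `𝕋M` near a point. -/
def IsSmoothAt (f : TangentGroupoid n M → ℝ) (γ : TangentGroupoid n M) : Prop :=
  ∃ (k : ℕ) (a : Fin k → tangentAlgebra n M) (h : (Fin k → ℝ) → ℝ),
    ContDiff ℝ ∞ h ∧ ∀ᶠ η in 𝓝 γ, f η = h (fun j => eval (a j) η)

/-- Arbitrary finite index types allow two families of generators to be joined by a disjoint union.
-/
theorem IsSmoothAt.of_fintype {ι : Type*} [Fintype ι] (a : ι → tangentAlgebra n M)
    {h : (ι → ℝ) → ℝ} (hh : ContDiff ℝ ∞ h) {f : TangentGroupoid n M → ℝ}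
    {γ : TangentGroupoid n M} (hf : ∀ᶠ η in 𝓝 γ, f η = h (fun j => eval (a j) η)) :
    IsSmoothAt f γ := by
  let e := Fintype.equivFin ι
  refine ⟨Fintype.card ι, a ∘ e.symm, fun u => h (u ∘ e), ?_, ?_⟩
  · exact hh.comp (contDiff_pi.2 fun i => contDiff_apply ℝ ℝ (e i))
  · filter_upwards [hf] with η hη
    rw [hη]
    congr 1
    funext i
    simp

theorem IsSmoothAt.congr {f g : TangentGroupoid n M → ℝ} {γ : TangentGroupoid n M}
    (hf : IsSmoothAt f γ) (h : ∀ᶠ η in 𝓝 γ, g η = f η) : IsSmoothAt g γ := by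
  obtain ⟨k, a, H, hH, hev⟩ := hf
  exact ⟨k, a, H, hH, by filter_upwards [h, hev] with η h₁ h₂ using h₁.trans h₂⟩

theorem IsSmoothAt.comp₂ {f g : TangentGroupoid n M → ℝ} {γ : TangentGroupoid n M}
    (hf : IsSmoothAt f γ) (hg : IsSmoothAt g γ) {F : ℝ × ℝ → ℝ} (hF : ContDiff ℝ ∞ F) :
    IsSmoothAt (fun η => F (f η, g η)) γ := by
  obtain ⟨k, a, h, hh, hev⟩ := hf
  obtain ⟨k', a', h', hh', hev'⟩ := hg
  refine IsSmoothAt.of_fintype (Sum.elim a a')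
    (h := fun u => F (h fun i => u (Sum.inl i), h' fun i => u (Sum.inr i))) ?_ ?_
  · exact hF.comp ((hh.comp (contDiff_pi.2 fun i => contDiff_apply ℝ ℝ (Sum.inl i))).prodMk
      (hh'.comp (contDiff_pi.2 fun i => contDiff_apply ℝ ℝ (Sum.inr i))))
  · filter_upwards [hev, hev'] with η h₁ h₂
    rw [h₁, h₂]
    rfl

theorem IsSmoothAt.add {f g : TangentGroupoid n M → ℝ} {γ : TangentGroupoid n M}
    (hf : IsSmoothAt f γ) (hg : IsSmoothAt g γ) : IsSmoothAt (fun η => f η + g η) γ :=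
  hf.comp₂ hg (F := fun z => z.1 + z.2) (contDiff_fst.add contDiff_snd)

theorem IsSmoothAt.mul {f g : TangentGroupoid n M → ℝ} {γ : TangentGroupoid n M}
    (hf : IsSmoothAt f γ) (hg : IsSmoothAt g γ) : IsSmoothAt (fun η => f η * g η) γ :=
  hf.comp₂ hg (F := fun z => z.1 * z.2) (contDiff_fst.mul contDiff_snd)

theorem isSmoothAt_comp {k : ℕ} (a : Fin k → tangentAlgebra n M) {h : (Fin k → ℝ) → ℝ}
    (hh : ContDiff ℝ ∞ h) (γ : TangentGroupoid n M) :
    IsSmoothAt (fun η => h fun j => eval (a j) η) γ :=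
  ⟨k, a, h, hh, Filter.Eventually.of_forall fun _ => rfl⟩

theorem isSmoothAt_eval (a : tangentAlgebra n M) (γ : TangentGroupoid n M) :
    IsSmoothAt (eval a) γ :=
  isSmoothAt_comp (fun _ : Fin 1 => a) (contDiff_apply ℝ ℝ 0) γ

theorem isSmoothAt_sum {ι : Type*} {s : Finset ι} {f : ι → TangentGroupoid n M → ℝ}
    {γ : TangentGroupoid n M} (hf : ∀ i ∈ s, IsSmoothAt (f i) γ) :
    IsSmoothAt (fun η => ∑ i ∈ s, f i η) γ := by
  classical
  induction s using Finset.induction_on with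
  | empty =>
    simpa using isSmoothAt_comp (n := n) (fun i : Fin 0 => i.elim0)
      (contDiff_const (c := (0 : ℝ))) γ
  | insert i s hi ih =>
    simp only [Finset.sum_insert hi]
    exact (hf i (Finset.mem_insert_self i s)).add
      (ih fun j hj => hf j (Finset.mem_insert_of_mem hj))

theorem continuous_of_continuous_eval {N : Type*} [TopologicalSpace N]
    {c : N → TangentGroupoid n M}
    (hc : ∀ a : tangentAlgebra n M, Continuous fun x => eval a (c x)) :
    Continuous c :=
  continuous_iInf_rng.2 fun a => continuous_induced_rng.2 (hc a)

theorem continuous_pair (m₂ : M) (l : ℝ) (hl : l ≠ 0) :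
    Continuous fun m₁ : M => (pair m₁ m₂ l hl : TangentGroupoid n M) :=
  continuous_of_continuous_eval fun a => (contMDiff_eval_pair a m₂ l hl).continuous

theorem continuous_tangent (m : M) :
    Continuous fun X : EuclideanSpace ℝ (Fin n) => (tangent m X : TangentGroupoid n M) :=
  continuous_of_continuous_eval fun a => (contMDiff_eval_tangent a m).continuous

/-! ### The operator family on the source fibers -/

variable {q : ℕ} {D : C^∞⟮𝓡 n, M; ℝ⟯ →ₗ[ℝ] C^∞⟮𝓡 n, M; ℝ⟯}

theorem conj_operatorFamily_pair (hD : IsDiffOp q D) (x : M × ℝ) (hx : x.2 ≠ 0) :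
    (fiberSmoothPair x hx).conj (operatorFamily hD x) = x.2 ^ q • D := by
  rw [operatorFamily, dif_neg hx]
  ext u
  simp [LinearEquiv.conj_apply]

theorem conj_operatorFamily_tangent (hD : IsDiffOp q D) (x : M × ℝ) (hx : x.2 = 0) :
    (fiberSmoothTangent x hx).conj (operatorFamily hD x) = modelOperator hD x.1 := by
  rw [operatorFamily, dif_pos hx]
  ext u
  simp [LinearEquiv.conj_apply]

theorem operatorFamily_pairPoint (hD : IsDiffOp q D) (x : M × ℝ) (hx : x.2 ≠ 0)
    (u : fiberSmooth n x) (m₁ : M) :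
    (operatorFamily hD x u).1 (pairPoint x hx m₁) = x.2 ^ q * D (fiberSmoothPair x hx u) m₁ := by
  have h := LinearMap.congr_fun (conj_operatorFamily_pair hD x hx) (fiberSmoothPair x hx u)
  rw [LinearEquiv.conj_apply_apply, LinearEquiv.symm_apply_apply] at h
  exact congrArg (fun g : C^∞⟮𝓡 n, M; ℝ⟯ => g m₁) h

theorem operatorFamily_tangentPoint (hD : IsDiffOp q D) (x : M × ℝ) (hx : x.2 = 0)
    (u : fiberSmooth n x) (X : EuclideanSpace ℝ (Fin n)) :
    (operatorFamily hD x u).1 (tangentPoint x hx X)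
      = modelOperator hD x.1 (fiberSmoothTangent x hx u) X := by
  have h := LinearMap.congr_fun (conj_operatorFamily_tangent hD x hx) (fiberSmoothTangent x hx u)
  rw [LinearEquiv.conj_apply_apply, LinearEquiv.symm_apply_apply] at h
  exact congrArg (fun g : C^∞⟮𝓡 n, EuclideanSpace ℝ (Fin n); ℝ⟯ => g X) h

theorem _root_.IsDiffOp.smul (hD : IsDiffOp q D) (c : ℝ) : IsDiffOp q (c • D) := by
  intro m
  obtain ⟨a, ha, ha'⟩ := hD m
  refine ⟨fun k w y => c * a k w y, fun k hk w => contDiffOn_const.mul (ha k hk w),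
    fun f m' hm' => ?_⟩
  change c * D f m' = _
  rw [ha' f m' hm', Finset.mul_sum]
  refine Finset.sum_congr rfl fun k _ => ?_
  rw [Finset.mul_sum]
  exact Finset.sum_congr rfl fun w _ => (mul_assoc _ _ _).symm

theorem isFiberDiffOp_operatorFamily [IsManifold (𝓡 n) ∞ M] (hD : IsDiffOp q D) (x : M × ℝ) :
    IsFiberDiffOp q x (operatorFamily hD x) := by
  refine ⟨fun hx => ?_, fun hx => ?_⟩
  · rw [conj_operatorFamily_pair hD x hx]
    exact hD.smul _
  · rw [conj_operatorFamily_tangent hD x hx]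
    exact isDiffOp_modelOperator hD x.1

/-- Points are characters, so restriction to a fiber is multiplicative; the operator applied to a
product of restrictions therefore comes from a single element of `A(𝕋M)`. -/
theorem pairFiber_prod [IsManifold (𝓡 n) ∞ M] {ι : Type*} (s : Finset ι)
    (a : ι → tangentAlgebra n M) (m₂ : M) (l : ℝ) (hl : l ≠ 0) :
    pairFiber m₂ l hl (∏ i ∈ s, a i) = ∏ i ∈ s, pairFiber m₂ l hl (a i) := by
  ext m
  rw [ContMDiffMap.prod_apply]
  change eval _ (pair m m₂ l hl) = ∏ i ∈ s, eval (a i) (pair m m₂ l hl)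
  simp only [← evalHom_apply, map_prod]

theorem tangentFiber_prod [IsManifold (𝓡 n) ∞ M] {ι : Type*} (s : Finset ι)
    (a : ι → tangentAlgebra n M) (m : M) :
    tangentFiber m (∏ i ∈ s, a i) = ∏ i ∈ s, tangentFiber m (a i) := by
  ext X
  rw [ContMDiffMap.prod_apply]
  change eval _ (tangent m X) = ∏ i ∈ s, eval (a i) (tangent m X)
  simp only [← evalHom_apply, map_prod]

/-- The family acts on functions of the form `h(a₁, …, a_k)` by Taylor expansion of `h`. -/
theorem applyFamily_eq_sum [IsManifold (𝓡 n) ∞ M] (hD : IsDiffOp q D)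
    {f : TangentGroupoid n M → ℝ} (hf : IsSmooth f) {k : ℕ} (a : Fin k → tangentAlgebra n M)
    {h : (Fin k → ℝ) → ℝ} (hh : ContDiff ℝ ∞ h)
    (b : (j : ℕ) → (Fin j → Fin k) → Finset (Fin j) → tangentAlgebra n M)
    (hb₁ : ∀ j w S m₁ m₂ l hl, eval (b j w S) (pair m₁ m₂ l hl)
      = l ^ q * D (pairFiber m₂ l hl (∏ i ∈ S, a (w i))) m₁)
    (hb₂ : ∀ j w S m (X : EuclideanSpace ℝ (Fin n)), eval (b j w S) (tangent m X)
      = modelOperator hD m (tangentFiber m (∏ i ∈ S, a (w i))) X)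
    {γ : TangentGroupoid n M} (hγ : ∀ᶠ η in 𝓝 γ, f η = h fun j => eval (a j) η) :
    applyFamily (operatorFamily hD) f hf γ
      = ∑ j ∈ Finset.range (q + 1), ∑ w : Fin j → Fin k, ∑ S : Finset (Fin j),
        ((j.factorial : ℝ)⁻¹ * iteratedFDeriv ℝ j h (fun j => eval (a j) γ)
          fun i => Pi.single (w i) 1) *
          ((∏ i ∈ Sᶜ, -eval (a (w i)) γ) * eval (b j w S) γ) := by
  cases γ with
  | tangent m X =>
    refine (operatorFamily_tangentPoint hD (m, 0) rfl (restrict f hf (m, 0)) X).trans ?_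
    -- The inclusion of the fiber is continuous, so the local formula for `f` restricts to it.
    have hev := ((continuous_tangent (n := n) m).tendsto X).eventually hγ
    refine ((isDiffOp_modelOperator hD m).apply_comp (fun j => tangentFiber m (a j)) hh
      (m := X) hev).trans ?_
    refine Finset.sum_congr rfl fun j _ => Finset.sum_congr rfl fun w _ =>
      Finset.sum_congr rfl fun S _ => ?_
    have h₂ := hb₂ j w S m X
    rw [tangentFiber_prod] at h₂
    exact congrArg (_ * ·) (congrArg (_ * ·) h₂.symm)
  | pair m₁ m₂ l hl =>
    refine (operatorFamily_pairPoint hD (m₂, l) hl (restrict f hf (m₂, l)) m₁).trans ?_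
    have hev := ((continuous_pair (n := n) m₂ l hl).tendsto m₁).eventually hγ
    refine (congrArg (l ^ q * ·) (hD.apply_comp (fun j => pairFiber m₂ l hl (a j)) hh
      (m := m₁) hev)).trans ?_
    simp only [hb₁, pairFiber_prod, Finset.mul_sum]
    refine Finset.sum_congr rfl fun j _ => Finset.sum_congr rfl fun w _ =>
      Finset.sum_congr rfl fun S _ => ?_
    rw [mul_left_comm, mul_left_comm (l ^ q)]
    rfl

theorem isSmoothAt_applyFamily [IsManifold (𝓡 n) ∞ M] (hD : IsDiffOp q D)
    {f : TangentGroupoid n M → ℝ} (hf : IsSmooth f) (γ : TangentGroupoid n M) :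
    IsSmoothAt (applyFamily (operatorFamily hD) f hf) γ := by
  obtain ⟨k, a, h, hh, hev⟩ := hf γ
  have hb : ∀ (j : ℕ) (w : Fin j → Fin k) (S : Finset (Fin j)), _ := fun j w S =>
    exists_eval_eq_apply hD (∏ i ∈ S, a (w i))
  choose b hb₁ hb₂ using hb
  -- The presentation of `f` by `h` and `a` holds around every `η` near `γ`, so one choice of `b`
  -- serves a whole neighbourhood.
  refine IsSmoothAt.congr ?_ (hev.eventually_nhds.mono fun η hη =>
    applyFamily_eq_sum hD hf a hh b hb₁ hb₂ hη)
  refine isSmoothAt_sum fun j _ => isSmoothAt_sum fun w _ => isSmoothAt_sum fun S _ => ?_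
  refine IsSmoothAt.mul ?_ (IsSmoothAt.mul ?_ (isSmoothAt_eval _ _))
  · refine isSmoothAt_comp a (h := fun u => (j.factorial : ℝ)⁻¹ *
      iteratedFDeriv ℝ j h u fun i => Pi.single (w i) 1) ?_ γ
    exact contDiff_const.mul ((ContinuousMultilinearMap.apply ℝ (fun _ : Fin j => Fin k → ℝ) ℝ
      _).contDiff.comp (hh.iteratedFDeriv_right (m := ∞) (by norm_cast)))
  · exact isSmoothAt_comp a (h := fun u => ∏ i ∈ Sᶜ, -u (w i))
      (contDiff_prod fun i _ => (contDiff_apply ℝ ℝ (w i)).neg) γ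

theorem isEquivariantFamily_operatorFamily [IsManifold (𝓡 n) ∞ M] (hD : IsDiffOp q D) :
    IsEquivariantFamily (operatorFamily hD) := by
  intro γ f
  apply Subtype.ext
  funext η
  cases γ with
  -- Right translation is `Y ↦ Y + X`, and `D_m` has constant coefficients.
  | tangent m X =>
    obtain ⟨Y, rfl⟩ := (tangentPoint_bijective (n := n) (m, (0 : ℝ)) rfl).2 η
    refine (operatorFamily_tangentPoint hD (m, 0) rfl _ Y).trans
      (Eq.trans ?_ (operatorFamily_tangentPoint hD (m, 0) rfl f
        ((show EuclideanSpace ℝ (Fin n) from Y) + (show EuclideanSpace ℝ (Fin n) from X))).symm)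
    exact modelOperator_apply_comp_add hD m (X := X) (fun _ => rfl) Y
  -- Both source fibers are copies of `M`, and right translation becomes the identity.
  | pair m₁ m₂ l hl =>
    obtain ⟨m', rfl⟩ := (pairPoint_bijective (n := n) (m₁, l) hl).2 η
    exact (operatorFamily_pairPoint hD (m₁, l) hl _ m').trans
      (operatorFamily_pairPoint hD (m₂, l) hl f m').symm

end SmoothFunctions

end TangentGroupoid

end

theorem mainTheorem8 (n : ℕ) (M : Type*) [TopologicalSpace M] [T2Space M]
    [SecondCountableTopology M] [ChartedSpace (EuclideanSpace ℝ (Fin n)) M]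
    [IsManifold (𝓡 n) ∞ M] (q : ℕ) (D : C^∞⟮𝓡 n, M; ℝ⟯ →ₗ[ℝ] C^∞⟮𝓡 n, M; ℝ⟯)
    (hD : IsDiffOp q D) :
    (∀ φ ∈ IsManifold.maximalAtlas (𝓡 n) ∞ M, ∀ a, HasLocalExpression q D φ a →
      ∀ m ∈ φ.source, modelOperator hD m = frozenOperator q φ a m) ∧
    TangentGroupoid.IsSmoothFamily q (TangentGroupoid.operatorFamily hD) ∧
    TangentGroupoid.IsEquivariantFamily (TangentGroupoid.operatorFamily hD) :=
  ⟨fun _ hφ _ ha _ hm => modelOperator_eq_frozenOperator hD hφ ha hm,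
    ⟨TangentGroupoid.isFiberDiffOp_operatorFamily hD,
      fun _ hf γ => TangentGroupoid.isSmoothAt_applyFamily hD hf γ⟩,
    TangentGroupoid.isEquivariantFamily_operatorFamily hD⟩
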